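/- Let $\mathcal H(2^{\mathbb N})$ be the group of homeomorphisms of the Cantor set $2^{\mathbb N}$, with the topology of uniform convergence (of $g$ and $g^{-1}$). Let $\sigma\in\mathcal H(2^{\mathbb N})$ be the generic homeomorphism, described in either of the following two ways: the conjugacy class of $\sigma$ is comeagre in $\mathcal H(2^{\mathbb N})$; or $\sigma$ has the Akin–Glasner–Weiss lifting property defined below. Then $(C(2^{\mathbb N}),\sigma)$, where $\sigma(f)=f\circ\sigma$, is the prime model of its theory, in continuous logic for the language of unital C*-algebras with an additional unary function symbol for the automorphism. That is, for every unital C*-algebra $B$ with a $*$-automorphism $\rho$ such that $(B,\rho)$ satisfies the theory of $(C(2^{\mathbb N}),\sigma)$, there is a map $h:C(2^{\mathbb N})\to B$ with $\varphi^{(B,\rho)}(h(\bar a))=\varphi^{(C(2^{\mathbb N}),\sigma)}(\bar a)$ for all formulas $\varphi$ and all tuples $\bar a$ from $C(2^{\mathbb N})$. Here formulas are built from the norms of $*$-polynomials (in which the symbol for the automorphism may occur) by continuous functions $\mathbb R^k\to\mathbb R$ and by $\sup$ and $\inf$ over closed balls of radius $r\in\mathbb N$, and the theory of a structure is the set of sentences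 with value $0$ in it. **Lifting property.** For $n\ge1$ the $n$-spiral $S_n$ consists of the points $(l,k)$ and $(r,k)$ for $k\in\mathbb Z/n!$ and $(m,k)$ for $k\in\{-n+1,\dots,n-1\}$. Its relation $R_n$ consists of $(l,k)R_n(l,k+1)$ and $(r,k)R_n(r,k+1)$ for $k\in\mathbb Z/n!$, of $(m,k)R_n(m,k+1)$ for $-n+1\le k<n-1$, and of $(l,-n \bmod n!)\,R_n\,(m,-n+1)$ and $(m,n-1)\,R_n\,(r,n \bmod n!)$. The maps $\xi_L,\xi_M,\xi_G:S_{n+1}\to S_n$ are $\xi_L(a,k)=(l,k\bmod n!)$, $\xi_G(a,k)=(r,k\bmod n!)$, and $\xi_M(a,k)=(a,k\bmod n!)$ for $a\in\{l,r\}$, $\xi_M(m,k)=(m,k)$ for $|k|<n$, $\xi_M(m,-n)=(l,-n\bmod n!)$, $\xi_M(m,n)=(r,n\bmod n!)$. Let $W_n$ be the disjoint union of $6^n$ copies of $S_n$, indexed by the words of length $n$ in the letters $\xi_{L_1},\xi_{L_2},\xi_{M_1},\xi_{M_2},\xi_{G_1},\xi_{G_2}$, with the union of the relations $R_n$ and the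 discrete topology. Let $\xi:W_{n+1}\to W_n$ drop the last letter of the word and apply to the point the map $\xi_L$, $\xi_M$ or $\xi_G$ named by that letter; compositions of these maps are the canonical maps $\xi:W_{n+k}\to W_n$. A continuous surjection $\phi:(X,\sigma)\to(W_n,R_n)$ is a continuous surjection $\phi:X\to W_n$ with $\phi(x)R_n\phi(\sigma(x))$ for all $x$. A homeomorphism $\sigma$ of the Cantor set $X$, with a compatible metric, has the lifting property if there is a continuous surjection $(X,\sigma)\to(W_1,R_1)$ and, for all $n\ge1$, $\varepsilon>0$ and every continuous surjection $\phi:(X,\sigma)\to(W_n,R_n)$, there are $k\ge1$ and a continuous surjection $\psi:(X,\sigma)\to(W_{n+k},R_{n+k})$ such that $\phi=\xi\circ\psi$ and all fibres of $\psi$ have diameter less than $\varepsilon$. -/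

import Mathlib

open Set Filter Topology Uniformity

universe u v

noncomputable section

/-! ## Continuous logic for unital C*-algebras with an automorphism -/

/-- Terms of the language of unital C*-algebras with an additional unary function symbol `aut`,
in the variables `x_0, …, x_{n-1}`: the *-polynomials, also allowing applications of `aut`. -/
inductive CTerm (n : ℕ) : Type
  | var (i : Fin n) : CTerm n
  | zero : CTerm n
  | one : CTerm n
  | add (s t : CTerm n) : CTerm n
  | mul (s t : CTerm n) : CTerm n
  | smul (c : ℂ) (t : CTerm n) : CTerm n
  | star (t : CTerm n) : CTerm n
  | aut (t : CTerm n) : CTerm n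

/-- Formulas of continuous logic with free variables among `x_0, …, x_{n-1}`. The atomic formulas
are the norms of terms (so `d(s, t) = ‖s - t‖` is one), the connectives are all continuous
functions `ℝᵏ → ℝ`, and the quantifiers are `sup` and `inf` over the closed ball of radius
`r`, for a natural number `r`. A quantifier binds variable `0` and shifts the other ones by `1`. -/
inductive CFormula : ℕ → Type
  | norm {n : ℕ} (t : CTerm n) : CFormula n
  | conn {n k : ℕ} (f : (Fin k → ℝ) → ℝ) (hf : Continuous f) (φ : Fin k → CFormula n) : CFormula n
  | sup {n : ℕ} (r : ℕ) (φ : CFormula (n + 1)) : CFormula n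
  | inf {n : ℕ} (r : ℕ) (φ : CFormula (n + 1)) : CFormula n

/-- A sentence is a formula without free variables. -/
abbrev CSentence : Type := CFormula 0

section Semantics

variable {A : Type u} [CStarAlgebra A]

/-- The interpretation of a term in `(A, τ)` at the tuple `a`. -/
def CTerm.eval (τ : A ≃⋆ₐ[ℂ] A) {n : ℕ} (a : Fin n → A) : CTerm n → A
  | .var i => a i
  | .zero => 0
  | .one => 1
  | .add s t => s.eval τ a + t.eval τ a
  | .mul s t => s.eval τ a * t.eval τ a
  | .smul c t => c • t.eval τ a
  | .star t => Star.star (t.eval τ a)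
  | .aut t => τ (t.eval τ a)

/-- The value `φ(a)` of a formula in `(A, τ)` at the tuple `a`. -/
def CFormula.value (τ : A ≃⋆ₐ[ℂ] A) : {n : ℕ} → CFormula n → (Fin n → A) → ℝ
  | _, .norm t, a => ‖t.eval τ a‖
  | _, .conn f _ φ, a => f (fun i => (φ i).value τ a)
  | _, .sup r φ, a => ⨆ b : Metric.closedBall (0 : A) (r : ℝ),
      φ.value τ (Fin.cons (α := fun _ => A) (b : A) a)
  | _, .inf r φ, a => ⨅ b : Metric.closedBall (0 : A) (r : ℝ),
      φ.value τ (Fin.cons (α := fun _ => A) (b : A) a)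

/-- The theory of `(A, τ)`: all sentences whose value in `(A, τ)` is `0`. -/
def theoryOf (τ : A ≃⋆ₐ[ℂ] A) : Set CSentence :=
  {φ | φ.value τ Fin.elim0 = 0}

/-- `(A, τ)` is a model of `T`. -/
def IsModelOf (τ : A ≃⋆ₐ[ℂ] A) (T : Set CSentence) : Prop :=
  ∀ φ ∈ T, φ.value τ Fin.elim0 = 0

/-- `h` is an elementary embedding of `(A, τ)` into `(B, ρ)`: it preserves the value of every
formula at every tuple. -/
def IsElementaryEmbedding {B : Type v} [CStarAlgebra B] (τ : A ≃⋆ₐ[ℂ] A) (ρ : B ≃⋆ₐ[ℂ] B)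
    (h : A → B) : Prop :=
  ∀ (n : ℕ) (φ : CFormula n) (a : Fin n → A), φ.value ρ (h ∘ a) = φ.value τ a

/-- `(A, τ)` is the prime model of its theory: it embeds elementarily into every model of its
theory. -/
def IsPrimeModelOfItsTheory (τ : A ≃⋆ₐ[ℂ] A) : Prop :=
  ∀ (B : Type v) [CStarAlgebra B] (ρ : B ≃⋆ₐ[ℂ] B), IsModelOf ρ (theoryOf τ) →
    ∃ h : A → B, IsElementaryEmbedding τ ρ h

/-! The supremum and the infimum in the definition of `CFormula.value` are taken over bounded
nonempty sets of real numbers. -/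

theorem CTerm.exists_norm_eval_le (τ : A ≃⋆ₐ[ℂ] A) {n : ℕ} (t : CTerm n) (R : ℝ) :
    ∃ C : ℝ, ∀ a : Fin n → A, (∀ i, ‖a i‖ ≤ R) → ‖t.eval τ a‖ ≤ C := by
  induction t with
  | var i => exact ⟨R, fun a ha => ha i⟩
  | zero => exact ⟨0, fun a _ => by simp [CTerm.eval]⟩
  | one => exact ⟨‖(1 : A)‖, fun a _ => le_rfl⟩
  | add s t hs ht =>
    obtain ⟨C, hC⟩ := hs
    obtain ⟨D, hD⟩ := ht
    exact ⟨C + D, fun a ha => (norm_add_le _ _).trans (add_le_add (hC a ha) (hD a ha))⟩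
  | mul s t hs ht =>
    obtain ⟨C, hC⟩ := hs
    obtain ⟨D, hD⟩ := ht
    exact ⟨C * D, fun a ha => (norm_mul_le _ _).trans
      (mul_le_mul (hC a ha) (hD a ha) (norm_nonneg _) ((norm_nonneg _).trans (hC a ha)))⟩
  | smul c t ht =>
    obtain ⟨C, hC⟩ := ht
    exact ⟨‖c‖ * C, fun a ha => by
      rw [CTerm.eval, norm_smul]
      exact mul_le_mul_of_nonneg_left (hC a ha) (norm_nonneg _)⟩
  | star t ht =>
    obtain ⟨C, hC⟩ := ht
    exact ⟨C, fun a ha => by rw [CTerm.eval, norm_star]; exact hC a ha⟩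
  | aut t ht =>
    obtain ⟨C, hC⟩ := ht
    exact ⟨C, fun a ha => by
      rw [CTerm.eval]
      exact (NonUnitalStarAlgHom.norm_apply_le τ _).trans (hC a ha)⟩

theorem CFormula.exists_abs_value_le (τ : A ≃⋆ₐ[ℂ] A) {n : ℕ} (φ : CFormula n) :
    ∀ R : ℝ, ∃ C : ℝ, ∀ a : Fin n → A, (∀ i, ‖a i‖ ≤ R) → |φ.value τ a| ≤ C := by
  have cons_le : ∀ {n r : ℕ} {R : ℝ} (a : Fin n → A) (_ : ∀ i, ‖a i‖ ≤ R)
      (b : Metric.closedBall (0 : A) (r : ℝ)) (i : Fin (n + 1)),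
      ‖Fin.cons (α := fun _ => A) (b : A) a i‖ ≤ max R r := by
    intro n r R a ha b i
    refine Fin.cases ?_ (fun j => ?_) i
    · simpa using Or.inr (mem_closedBall_zero_iff.mp b.2)
    · simpa using Or.inl (ha j)
  induction φ with
  | norm t =>
    intro R
    obtain ⟨C, hC⟩ := t.exists_norm_eval_le τ R
    exact ⟨C, fun a ha => by simpa [CFormula.value] using hC a ha⟩
  | @conn n k f hf φ ih =>
    intro R
    choose C hC using fun i => ih i R
    have hK : IsCompact (Set.pi Set.univ fun i => Set.Icc (-(C i)) (C i)) :=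
      isCompact_univ_pi fun i => isCompact_Icc
    obtain ⟨D, hD⟩ := hK.exists_bound_of_continuousOn hf.continuousOn
    exact ⟨D, fun a ha => hD _ fun i _ => abs_le.mp (hC i a ha)⟩
  | sup r φ ih =>
    intro R
    obtain ⟨C, hC⟩ := ih (max R r)
    refine ⟨C, fun a ha => ?_⟩
    have : Nonempty (Metric.closedBall (0 : A) (r : ℝ)) := ⟨⟨0, by simp⟩⟩
    have hb := fun b => abs_le.mp (hC _ (cons_le a ha b))
    rw [CFormula.value, abs_le]
    refine ⟨?_, ciSup_le fun b => (hb b).2⟩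
    exact le_ciSup_of_le ⟨C, by rintro _ ⟨b, rfl⟩; exact (hb b).2⟩ (Classical.arbitrary _) (hb _).1
  | inf r φ ih =>
    intro R
    obtain ⟨C, hC⟩ := ih (max R r)
    refine ⟨C, fun a ha => ?_⟩
    have : Nonempty (Metric.closedBall (0 : A) (r : ℝ)) := ⟨⟨0, by simp⟩⟩
    have hb := fun b => abs_le.mp (hC _ (cons_le a ha b))
    rw [CFormula.value, abs_le]
    refine ⟨le_ciInf fun b => (hb b).1, ?_⟩
    exact ciInf_le_of_le ⟨-C, by rintro _ ⟨b, rfl⟩; exact (hb b).1⟩ (Classical.arbitrary _) (hb _).2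

end Semantics

/-! ## Generic homeomorphisms -/

/-- The usual topology on the group of homeomorphisms of `X`: convergence of `g` and of `g⁻¹` in the
compact-open topology (uniform convergence of both, if `X` is a compact metric space). -/
abbrev homeoTopology (X : Type*) [TopologicalSpace X] : TopologicalSpace (X ≃ₜ X) :=
  TopologicalSpace.induced (fun g => ((g : C(X, X)), (g.symm : C(X, X)))) inferInstance

/-- `σ` is generic: its conjugacy class is comeagre in the group of homeomorphisms of `X`. -/
def IsGenericHomeo {X : Type*} [TopologicalSpace X] (σ : X ≃ₜ X) : Prop :=
  {τ : X ≃ₜ X | IsConj σ τ} ∈ @residual (X ≃ₜ X) (homeoTopology X)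

/-! ## Spirals and the lifting property -/

/-- The points of the `n`-spiral: two cycles of length `n!`, called left and right, and a middle
segment `{-n+1, …, n-1}`. -/
inductive Spiral (n : ℕ) : Type
  | left (k : ZMod n.factorial) : Spiral n
  | mid (k : ℤ) (hk : |k| < n) : Spiral n
  | right (k : ZMod n.factorial) : Spiral n

/-- The relation of the `n`-spiral: on the two cycles it is `k ↦ k + 1`; the left cycle leads to the
first point of the middle segment, along which one moves to its last point, and from there to the
right cycle. -/
inductive Spiral.Rel (n : ℕ) : Spiral n → Spiral n → Prop
  | left (k : ZMod n.factorial) : Rel n (.left k) (.left (k + 1))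
  | right (k : ZMod n.factorial) : Rel n (.right k) (.right (k + 1))
  | mid (k : ℤ) (hk : |k| < n) (hk' : |k + 1| < n) : Rel n (.mid k hk) (.mid (k + 1) hk')
  | enter (h : |-(n : ℤ) + 1| < n) : Rel n (.left ((-(n : ℤ) : ℤ) : ZMod n.factorial)) (.mid _ h)
  | exit (h : |(n : ℤ) - 1| < n) : Rel n (.mid _ h) (.right ((n : ℤ) : ZMod n.factorial))

/-- Reduction from integers modulo `(n+1)!` to integers modulo `n!`. -/
def factorialReduce (n : ℕ) : ZMod (n + 1).factorial →+* ZMod n.factorial :=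
  ZMod.castHom (Nat.factorial_dvd_factorial n.le_succ) _

/-- The number `k` of a point `(a, k)` of the `(n+1)`-spiral, reduced modulo `n!`. -/
def Spiral.position (n : ℕ) : Spiral (n + 1) → ZMod n.factorial
  | .left k => factorialReduce n k
  | .mid k _ => (k : ZMod n.factorial)
  | .right k => factorialReduce n k

/-- The map `ξ_L`, which collapses the `(n+1)`-spiral onto the left cycle of the `n`-spiral. -/
def Spiral.xiL (n : ℕ) (s : Spiral (n + 1)) : Spiral n := .left (s.position n)

/-- The map `ξ_G`, which collapses the `(n+1)`-spiral onto the right cycle of the `n`-spiral. -/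
def Spiral.xiG (n : ℕ) (s : Spiral (n + 1)) : Spiral n := .right (s.position n)

/-- The map `ξ_M`, which projects the `(n+1)`-spiral straight down onto the `n`-spiral. The two
extreme points `-n` and `n` of the middle segment go to the left and to the right cycle. -/
def Spiral.xiM (n : ℕ) : Spiral (n + 1) → Spiral n
  | .left k => .left (factorialReduce n k)
  | .mid k _ => if h : |k| < n then .mid k h else if k < 0 then .left k else .right k
  | .right k => .right (factorialReduce n k)

/-- The three kinds of letters. -/
inductive XiKind : Type
  | L : XiKind
  | M : XiKind
  | G : XiKind

/-- The alphabet of the six letters `ξ_{L_1}, ξ_{L_2}, ξ_{M_1}, ξ_{M_2}, ξ_{G_1}, ξ_{G_2}`. -/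
abbrev XiLetter : Type := XiKind × Fin 2

/-- `W_n` is the disjoint union of `6^n` copies of the `n`-spiral, indexed by the words of length `n`
over the alphabet of six letters. -/
abbrev SpiralUnion (n : ℕ) : Type := (Fin n → XiLetter) × Spiral n

/-- The relation `R_n` on `W_n`. -/
def SpiralUnion.Rel (n : ℕ) (x y : SpiralUnion n) : Prop :=
  x.1 = y.1 ∧ Spiral.Rel n x.2 y.2

/-- The map of spirals given by a letter. -/
def XiKind.map (n : ℕ) : XiKind → Spiral (n + 1) → Spiral n
  | .L => Spiral.xiL n
  | .M => Spiral.xiM n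
  | .G => Spiral.xiG n

/-- The map `ξ : W_{n+1} → W_n`: drop the last letter of the word and apply its map. -/
def SpiralUnion.xi (n : ℕ) (x : SpiralUnion (n + 1)) : SpiralUnion n :=
  (Fin.init (α := fun _ => XiLetter) x.1, (x.1 (Fin.last n)).1.map n x.2)

/-- The canonical map `ξ : W_{n+k} → W_n`. -/
def SpiralUnion.xiIter (n : ℕ) : (k : ℕ) → SpiralUnion (n + k) → SpiralUnion n
  | 0 => id
  | k + 1 => SpiralUnion.xiIter n k ∘ SpiralUnion.xi (n + k)

/-- `φ : (X, σ) → (W_n, R_n)` is a continuous surjection (where `W_n` is discrete) such that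
`φ(x) R_n φ(σ(x))` for all `x`. -/
structure IsSpiralMap {X : Type*} [TopologicalSpace X] (σ : X ≃ₜ X) {n : ℕ}
    (φ : X → SpiralUnion n) : Prop where
  locallyConstant : IsLocallyConstant φ
  surjective : Function.Surjective φ
  rel : ∀ x, SpiralUnion.Rel n (φ x) (φ (σ x))

/-- The lifting property: there is a continuous surjection of `(X, σ)` onto `(W_1, R_1)`, and every
continuous surjection onto some `(W_n, R_n)`, `n ≥ 1`, lifts along the canonical map to one onto
some `(W_{n+k}, R_{n+k})`, `k ≥ 1`, with arbitrarily small fibres. The smallness of the fibres is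
measured by entourages; for a compact metric space this is the same as the diameters being less than
a given `ε > 0`. -/
def HasLiftingProperty {X : Type*} [UniformSpace X] (σ : X ≃ₜ X) : Prop :=
  (∃ φ : X → SpiralUnion 1, IsSpiralMap σ φ) ∧
  ∀ n : ℕ, 1 ≤ n → ∀ φ : X → SpiralUnion n, IsSpiralMap σ φ → ∀ V ∈ 𝓤 X,
    ∃ k : ℕ, 1 ≤ k ∧ ∃ ψ : X → SpiralUnion (n + k), IsSpiralMap σ ψ ∧
      (∀ x y, ψ x = ψ y → (x, y) ∈ V) ∧ φ = SpiralUnion.xiIter n k ∘ ψ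

end

/-!
The proof rests on two facts about a homeomorphism `σ` of the Cantor set `X` with the lifting
property.

*Homogeneity.* Any two maps of `(X, σ)` onto the same `(W_n, R_n)` differ by a homeomorphism of `X`
that commutes with `σ` (`HasLiftingProperty.exists_homeomorph`). Lifting both maps back and forth
with finer and finer fibres writes `X` in two ways as the inverse limit of the same sequence of
spiral unions, and the limit carries only one dynamics: although a point of `W_{n+1}` can have two
successors, these have the same image in `W_n` (`SpiralUnion.Rel.xi_eq`).

*Stability.* A map of a compact system `(K, r)` onto `(W_n, R_n)` is the same thing as a tuple of
projections of `C(K)` satisfying finitely many relations, and a tuple that almost satisfies them is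
close to one that does so exactly (`exists_norm_sub_indTuple_le`).

By homogeneity a formula has the same value at all such tuples of `C(X)`, and by stability this is
expressed by sentences. A model of the theory is commutative, hence of the form `C(K)` with the
automorphism induced by a homeomorphism `r` of `K`, and so every formula has the same value at the
tuples of `C(K)` as at those of `C(X)` (`IsModelOf.value_indTuple_eq`). Applied to the formula that
says how well a tuple lifts one level up, this shows that maps of `(K, r)` onto spiral unions can be
lifted. Starting from compatible sequences of such maps on `X`, with fibres shrinking to points, and
on `K`, one obtains a continuous map `π : K → X` that matches them. Then `f ↦ f ∘ π` is elementary: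
functions on `X` are uniformly approximated by linear combinations of the projections.

A generic homeomorphism has the lifting property because the homeomorphisms with this property are
comeagre and closed under conjugation, and the homeomorphism group is a Baire space. The lifting
property is a conjunction of countably many open conditions. Each of them is dense: given `σ` and
a clopen partition, finitely many orbits of `σ` are wrapped around large spirals, closing them up at
repetitions far in the past and in the future (`exists_represents`). This yields a map from a spiral
union onto the graph of transitions between the sets of the partition, and every such map is
realized by a homeomorphism of the Cantor set close to `σ` (`exists_homeomorph_of_graph`).
-/

/-! ### Substitution, finite sums and blocks of quantifiers -/

/-- Substitution of the terms `s i` for the variables `x_i` in a term. -/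
def CTerm.subst {n m : ℕ} (s : Fin n → CTerm m) : CTerm n → CTerm m
  | .var i => s i
  | .zero => .zero
  | .one => .one
  | .add t t' => .add (t.subst s) (t'.subst s)
  | .mul t t' => .mul (t.subst s) (t'.subst s)
  | .smul c t => .smul c (t.subst s)
  | .star t => .star (t.subst s)
  | .aut t => .aut (t.subst s)

/-- Capture-avoiding substitution of the terms `s i` for the free variables `x_i` of a formula:
below a quantifier the bound variable `0` is kept and the variables of the terms are shifted. -/
def CFormula.subst : {n : ℕ} → CFormula n → {m : ℕ} → (Fin n → CTerm m) → CFormula m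
  | _, .norm t, _, s => .norm (t.subst s)
  | _, .conn f hf φ, _, s => .conn f hf fun i => (φ i).subst s
  | _, .sup r φ, _, s => .sup r (φ.subst
      (Fin.cons (α := fun _ => CTerm _) (.var 0) fun i => (s i).subst fun j => .var j.succ))
  | _, .inf r φ, _, s => .inf r (φ.subst
      (Fin.cons (α := fun _ => CTerm _) (.var 0) fun i => (s i).subst fun j => .var j.succ))

/-- The sum of a finite family of terms. -/
noncomputable def CTerm.sum {n : ℕ} {ι : Type*} (s : Finset ι) (t : ι → CTerm n) : CTerm n :=
  (s.toList.map t).foldr .add .zero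

/-- The difference of two terms. -/
def CTerm.sub {n : ℕ} (s t : CTerm n) : CTerm n := .add s (.smul (-1) t)

/-- The sum of a finite family of formulas. -/
noncomputable def CFormula.sum {n : ℕ} {ι : Type*} [Fintype ι] (φ : ι → CFormula n) : CFormula n :=
  .conn (k := Fintype.card ι) (fun v => ∑ i, v i) (by fun_prop)
    (fun i => φ ((Fintype.equivFin ι).symm i))

/-- A continuous function of the value of one formula. -/
def CFormula.comp {n : ℕ} (f : ℝ → ℝ) (hf : Continuous f) (φ : CFormula n) : CFormula n :=
  .conn (k := 1) (fun v => f (v 0)) (hf.comp (continuous_apply 0)) (fun _ => φ)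

/-- A continuous function of the values of two formulas. -/
def CFormula.comp₂ {n : ℕ} (f : ℝ → ℝ → ℝ) (hf : Continuous fun p : ℝ × ℝ => f p.1 p.2)
    (φ ψ : CFormula n) : CFormula n :=
  .conn (k := 2) (fun v => f (v 0) (v 1))
    (hf.comp (f := fun v : Fin 2 → ℝ => (v 0, v 1)) (by fun_prop)) ![φ, ψ]

/-- The supremum over the first `m` variables, all of them ranging over the ball of radius `r`. -/
def CFormula.supBlock (r : ℕ) {n : ℕ} : (m : ℕ) → CFormula (n + m) → CFormula n
  | 0, φ => φ
  | m + 1, φ => CFormula.supBlock r m (.sup r φ)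

/-- The infimum over the first `m` variables, all of them ranging over the ball of radius `r`. -/
def CFormula.infBlock (r : ℕ) {n : ℕ} (m : ℕ) (φ : CFormula (n + m)) : CFormula n :=
  .comp (fun v => -v) continuous_neg (.supBlock r m (.comp (fun v => -v) continuous_neg φ))

/-- The tuple consisting of `b` followed by `a`, in the order in which `CFormula.supBlock` binds
the variables. -/
def blockTuple {A : Type*} {n : ℕ} : {m : ℕ} → (Fin m → A) → (Fin n → A) → Fin (n + m) → A
  | 0, _, a => a
  | m + 1, b, a => Fin.cons (α := fun _ => A) (b 0) (blockTuple (m := m) (Fin.tail b) a)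

/-- The position in a block tuple of the `i`-th entry of its first part. -/
def blockFst {n : ℕ} : {m : ℕ} → Fin m → Fin (n + m)
  | _ + 1, i => Fin.cases 0 (fun j => (blockFst j).succ) i

/-- The position in a block tuple of the `i`-th entry of its second part. -/
def blockSnd {n : ℕ} : {m : ℕ} → Fin n → Fin (n + m)
  | 0, i => i
  | m + 1, i => (blockSnd (m := m) i).succ

theorem blockTuple_fst {A : Type*} {n m : ℕ} (b : Fin m → A) (a : Fin n → A) (i : Fin m) :
    blockTuple b a (blockFst i) = b i := by
  induction m with
  | zero => exact i.elim0
  | succ m ih =>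
    refine Fin.cases ?_ (fun j => ?_) i
    · simp [blockTuple, blockFst]
    · simpa [blockTuple, blockFst, Fin.tail] using ih (Fin.tail b) j

theorem blockTuple_snd {A : Type*} {n m : ℕ} (b : Fin m → A) (a : Fin n → A) (i : Fin n) :
    blockTuple b a (blockSnd i) = a i := by
  induction m with
  | zero => rfl
  | succ m ih => simpa [blockTuple, blockSnd] using ih (Fin.tail b)

section Semantics

variable {A : Type u} [CStarAlgebra A] (τ : A ≃⋆ₐ[ℂ] A)

theorem CTerm.eval_subst {n m : ℕ} (s : Fin n → CTerm m) (t : CTerm n) (a : Fin m → A) :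
    (t.subst s).eval τ a = t.eval τ fun i => (s i).eval τ a := by
  induction t with
  | var i => rfl
  | zero => rfl
  | one => rfl
  | add s t hs ht => simp only [CTerm.subst, CTerm.eval, hs, ht]
  | mul s t hs ht => simp only [CTerm.subst, CTerm.eval, hs, ht]
  | smul c t ht => simp only [CTerm.subst, CTerm.eval, ht]
  | star t ht => simp only [CTerm.subst, CTerm.eval, ht]
  | aut t ht => simp only [CTerm.subst, CTerm.eval, ht]

theorem eval_cons_subst {n m : ℕ} (s : Fin n → CTerm m) (a : Fin m → A) (b : A) :
    (fun i => (Fin.cons (α := fun _ => CTerm (m + 1)) (.var 0)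
        (fun i => (s i).subst fun j => .var j.succ) i).eval τ (Fin.cons (α := fun _ => A) b a)) =
      Fin.cons (α := fun _ => A) b fun i => (s i).eval τ a := by
  funext i
  refine Fin.cases ?_ (fun j => ?_) i
  · simp [CTerm.eval]
  · simp [CTerm.eval_subst, CTerm.eval]

theorem CFormula.value_subst {n : ℕ} (φ : CFormula n) : ∀ {m : ℕ} (s : Fin n → CTerm m)
    (a : Fin m → A), (φ.subst s).value τ a = φ.value τ fun i => (s i).eval τ a := by
  induction φ with
  | norm t => intro m s a; simp only [CFormula.subst, CFormula.value, CTerm.eval_subst]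
  | conn f hf φ ih => intro m s a; simp only [CFormula.subst, CFormula.value, ih]
  | sup r φ ih =>
    intro m s a
    simp only [CFormula.subst, CFormula.value, ih, eval_cons_subst]
  | inf r φ ih =>
    intro m s a
    simp only [CFormula.subst, CFormula.value, ih, eval_cons_subst]

theorem CTerm.eval_sum {n : ℕ} {ι : Type*} (s : Finset ι) (t : ι → CTerm n) (a : Fin n → A) :
    (CTerm.sum s t).eval τ a = ∑ i ∈ s, (t i).eval τ a := by
  rw [← Finset.sum_map_toList, CTerm.sum]
  induction s.toList with
  | nil => rfl
  | cons i l ih => simp [CTerm.eval, ih]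

theorem CTerm.eval_sub {n : ℕ} (s t : CTerm n) (a : Fin n → A) :
    (s.sub t).eval τ a = s.eval τ a - t.eval τ a := by
  simp [CTerm.sub, CTerm.eval, sub_eq_add_neg]

theorem CFormula.value_sum {n : ℕ} {ι : Type*} [Fintype ι] (φ : ι → CFormula n) (a : Fin n → A) :
    (CFormula.sum φ).value τ a = ∑ i, (φ i).value τ a := by
  rw [CFormula.sum, CFormula.value]
  exact Equiv.sum_comp (Fintype.equivFin ι).symm fun i => (φ i).value τ a

theorem CFormula.value_comp {n : ℕ} (f : ℝ → ℝ) (hf : Continuous f) (φ : CFormula n)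
    (a : Fin n → A) : (φ.comp f hf).value τ a = f (φ.value τ a) := rfl

theorem CFormula.value_comp₂ {n : ℕ} (f : ℝ → ℝ → ℝ) (hf : Continuous fun p : ℝ × ℝ => f p.1 p.2)
    (φ ψ : CFormula n) (a : Fin n → A) :
    (CFormula.comp₂ f hf φ ψ).value τ a = f (φ.value τ a) (ψ.value τ a) := rfl

theorem norm_cons_le {n : ℕ} {R r : ℝ} {a : Fin n → A} (ha : ∀ i, ‖a i‖ ≤ R) {b : A}
    (hb : ‖b‖ ≤ r) (i : Fin (n + 1)) : ‖Fin.cons (α := fun _ => A) b a i‖ ≤ max R r := by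
  refine Fin.cases ?_ (fun j => ?_) i
  · simpa using Or.inr hb
  · simpa using Or.inl (ha j)

theorem CFormula.exists_abs_value_cons_le {n : ℕ} (φ : CFormula (n + 1)) (r : ℕ) (R : ℝ) :
    ∃ C : ℝ, ∀ a : Fin n → A, (∀ i, ‖a i‖ ≤ R) → ∀ b : Metric.closedBall (0 : A) (r : ℝ),
      |φ.value τ (Fin.cons (α := fun _ => A) (b : A) a)| ≤ C := by
  obtain ⟨C, hC⟩ := φ.exists_abs_value_le τ (max R r)
  exact ⟨C, fun a ha b => hC _ (norm_cons_le ha (mem_closedBall_zero_iff.mp b.2))⟩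

instance (r : ℕ) : Nonempty (Metric.closedBall (0 : A) (r : ℝ)) := ⟨⟨0, by simp⟩⟩

theorem exists_forall_norm_le {n : ℕ} (a : Fin n → A) : ∃ R : ℝ, ∀ i, ‖a i‖ ≤ R :=
  ⟨∑ i, ‖a i‖, fun i => Finset.single_le_sum (f := fun i => ‖a i‖) (fun _ _ => norm_nonneg _)
    (Finset.mem_univ i)⟩

theorem CFormula.bddAbove_value_cons {n : ℕ} (φ : CFormula (n + 1)) (r : ℕ) (a : Fin n → A) :
    BddAbove (range fun b : Metric.closedBall (0 : A) (r : ℝ) =>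
      φ.value τ (Fin.cons (α := fun _ => A) (b : A) a)) := by
  obtain ⟨R, hR⟩ := exists_forall_norm_le a
  obtain ⟨C, hC⟩ := φ.exists_abs_value_cons_le τ r R
  exact ⟨C, by rintro _ ⟨b, rfl⟩; exact (abs_le.mp (hC a hR b)).2⟩

theorem CFormula.bddBelow_value_cons {n : ℕ} (φ : CFormula (n + 1)) (r : ℕ) (a : Fin n → A) :
    BddBelow (range fun b : Metric.closedBall (0 : A) (r : ℝ) =>
      φ.value τ (Fin.cons (α := fun _ => A) (b : A) a)) := by
  obtain ⟨R, hR⟩ := exists_forall_norm_le a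
  obtain ⟨C, hC⟩ := φ.exists_abs_value_cons_le τ r R
  exact ⟨-C, by rintro _ ⟨b, rfl⟩; exact (abs_le.mp (hC a hR b)).1⟩

theorem CFormula.value_supBlock_le_iff (r : ℕ) {n m : ℕ} (φ : CFormula (n + m)) (a : Fin n → A)
    (c : ℝ) : (φ.supBlock r m).value τ a ≤ c ↔
      ∀ b : Fin m → A, (∀ i, ‖b i‖ ≤ r) → φ.value τ (blockTuple b a) ≤ c := by
  induction m with
  | zero => exact ⟨fun h b _ => h, fun h => h Fin.elim0 fun i => i.elim0⟩
  | succ m ih =>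
    rw [CFormula.supBlock, ih]
    constructor
    · intro h b hb
      exact (ciSup_le_iff (φ.bddAbove_value_cons τ r _)).mp (h (Fin.tail b) fun i => hb i.succ)
        ⟨b 0, mem_closedBall_zero_iff.mpr (hb 0)⟩
    · intro h b hb
      refine (ciSup_le_iff (φ.bddAbove_value_cons τ r _)).mpr fun x => ?_
      have := h (Fin.cons (α := fun _ => A) x b) fun i => by
        refine Fin.cases ?_ (fun j => ?_) i
        · simpa using mem_closedBall_zero_iff.mp x.2
        · simpa using hb j
      simpa [blockTuple] using this

theorem CFormula.value_infBlock_lt_iff (r : ℕ) {n m : ℕ} (φ : CFormula (n + m)) (a : Fin n → A)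
    (c : ℝ) : (φ.infBlock r m).value τ a < c ↔
      ∃ b : Fin m → A, (∀ i, ‖b i‖ ≤ r) ∧ φ.value τ (blockTuple b a) < c := by
  rw [CFormula.infBlock, value_comp, ← not_le, le_neg, value_supBlock_le_iff]
  simp only [value_comp]
  push Not
  refine exists_congr fun b => and_congr_right fun _ => ?_
  rw [neg_lt_neg_iff]

/-! ### Uniform continuity and invariance of formulas -/

theorem CTerm.exists_norm_eval_sub_le {n : ℕ} (t : CTerm n) (R : ℝ) {ε : ℝ} (hε : 0 < ε) :
    ∃ δ > 0, ∀ a b : Fin n → A, (∀ i, ‖a i‖ ≤ R) → (∀ i, ‖b i‖ ≤ R) →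
      (∀ i, ‖a i - b i‖ ≤ δ) → ‖t.eval τ a - t.eval τ b‖ ≤ ε := by
  induction t generalizing ε with
  | var i => exact ⟨ε, hε, fun a b _ _ h => h i⟩
  | zero => exact ⟨1, one_pos, fun a b _ _ _ => by simpa [CTerm.eval] using hε.le⟩
  | one => exact ⟨1, one_pos, fun a b _ _ _ => by simpa [CTerm.eval] using hε.le⟩
  | add s t hs ht =>
    obtain ⟨δ, hδ, h⟩ := hs (half_pos hε)
    obtain ⟨δ', hδ', h'⟩ := ht (half_pos hε)
    refine ⟨min δ δ', lt_min hδ hδ', fun a b ha hb hab => ?_⟩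
    have h1 := h a b ha hb fun i => (hab i).trans (min_le_left _ _)
    have h2 := h' a b ha hb fun i => (hab i).trans (min_le_right _ _)
    rw [CTerm.eval, CTerm.eval, add_sub_add_comm]
    linarith [norm_add_le (s.eval τ a - s.eval τ b) (t.eval τ a - t.eval τ b)]
  | mul s t hs ht =>
    obtain ⟨C, hC⟩ := s.exists_norm_eval_le τ R
    obtain ⟨D, hD⟩ := t.exists_norm_eval_le τ R
    have hη : 0 < ε / (|C| + |D| + 1) := by positivity
    obtain ⟨δ, hδ, h⟩ := hs hη
    obtain ⟨δ', hδ', h'⟩ := ht hη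
    refine ⟨min δ δ', lt_min hδ hδ', fun a b ha hb hab => ?_⟩
    have h1 := h a b ha hb fun i => (hab i).trans (min_le_left _ _)
    have h2 := h' a b ha hb fun i => (hab i).trans (min_le_right _ _)
    rw [CTerm.eval, CTerm.eval]
    have h3 : s.eval τ a * t.eval τ a - s.eval τ b * t.eval τ b =
        s.eval τ a * (t.eval τ a - t.eval τ b) + (s.eval τ a - s.eval τ b) * t.eval τ b := by
      noncomm_ring
    rw [h3]
    calc _ ≤ ‖s.eval τ a‖ * ‖t.eval τ a - t.eval τ b‖ + ‖s.eval τ a - s.eval τ b‖ * ‖t.eval τ b‖ :=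
          (norm_add_le _ _).trans (add_le_add (norm_mul_le _ _) (norm_mul_le _ _))
      _ ≤ |C| * (ε / (|C| + |D| + 1)) + (ε / (|C| + |D| + 1)) * |D| := by
          gcongr
          · exact (hC a ha).trans (le_abs_self C)
          · exact (hD b hb).trans (le_abs_self D)
      _ ≤ (|C| + |D| + 1) * (ε / (|C| + |D| + 1)) := by nlinarith
      _ = ε := by field_simp
  | smul c t ht =>
    have hη : 0 < ε / (‖c‖ + 1) := by positivity
    obtain ⟨δ, hδ, h⟩ := ht hη
    refine ⟨δ, hδ, fun a b ha hb hab => ?_⟩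
    rw [CTerm.eval, CTerm.eval, ← smul_sub, norm_smul]
    calc _ ≤ ‖c‖ * (ε / (‖c‖ + 1)) := by gcongr; exact h a b ha hb hab
      _ ≤ (‖c‖ + 1) * (ε / (‖c‖ + 1)) := by gcongr; linarith
      _ = ε := by field_simp
  | star t ht =>
    obtain ⟨δ, hδ, h⟩ := ht hε
    refine ⟨δ, hδ, fun a b ha hb hab => ?_⟩
    rw [CTerm.eval, CTerm.eval, ← star_sub, norm_star]
    exact h a b ha hb hab
  | aut t ht =>
    obtain ⟨δ, hδ, h⟩ := ht hε
    refine ⟨δ, hδ, fun a b ha hb hab => ?_⟩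
    rw [CTerm.eval, CTerm.eval, ← map_sub]
    exact (NonUnitalStarAlgHom.norm_apply_le τ _).trans (h a b ha hb hab)

theorem abs_ciSup_sub_ciSup_le {ι : Type*} [Nonempty ι] {f g : ι → ℝ} {ε : ℝ}
    (hf : BddAbove (range f)) (hg : BddAbove (range g)) (h : ∀ i, |f i - g i| ≤ ε) :
    |(⨆ i, f i) - ⨆ i, g i| ≤ ε := by
  rw [abs_sub_le_iff, sub_le_iff_le_add, sub_le_iff_le_add]
  constructor
  · exact ciSup_le fun i => by linarith [(abs_sub_le_iff.mp (h i)).1, le_ciSup hg i]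
  · exact ciSup_le fun i => by linarith [(abs_sub_le_iff.mp (h i)).2, le_ciSup hf i]

theorem abs_ciInf_sub_ciInf_le {ι : Type*} [Nonempty ι] {f g : ι → ℝ} {ε : ℝ}
    (hf : BddBelow (range f)) (hg : BddBelow (range g)) (h : ∀ i, |f i - g i| ≤ ε) :
    |(⨅ i, f i) - ⨅ i, g i| ≤ ε := by
  have h1 : (⨅ i, f i) - ε ≤ ⨅ i, g i :=
    le_ciInf fun i => by linarith [(abs_sub_le_iff.mp (h i)).1, ciInf_le hf i]
  have h2 : (⨅ i, g i) - ε ≤ ⨅ i, f i :=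
    le_ciInf fun i => by linarith [(abs_sub_le_iff.mp (h i)).2, ciInf_le hg i]
  rw [abs_sub_le_iff]
  constructor <;> linarith

theorem CFormula.exists_abs_value_sub_le {n : ℕ} (φ : CFormula n) : ∀ (R : ℝ) {ε : ℝ} (_ : 0 < ε),
    ∃ δ > 0, ∀ a b : Fin n → A, (∀ i, ‖a i‖ ≤ R) → (∀ i, ‖b i‖ ≤ R) →
      (∀ i, ‖a i - b i‖ ≤ δ) → |φ.value τ a - φ.value τ b| ≤ ε := by
  have cons_sub : ∀ {n : ℕ} {δ : ℝ} (_ : 0 < δ) {a b : Fin n → A} (_ : ∀ i, ‖a i - b i‖ ≤ δ)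
      (x : A) (i : Fin (n + 1)), ‖Fin.cons (α := fun _ => A) x a i -
        Fin.cons (α := fun _ => A) x b i‖ ≤ δ := by
    intro n δ hδ a b hab x i
    refine Fin.cases ?_ (fun j => ?_) i
    · simpa using hδ.le
    · simpa using hab j
  induction φ with
  | norm t =>
    intro R ε hε
    obtain ⟨δ, hδ, h⟩ := t.exists_norm_eval_sub_le τ R hε
    exact ⟨δ, hδ, fun a b ha hb hab => (abs_norm_sub_norm_le _ _).trans (h a b ha hb hab)⟩
  | @conn n k f hf φ ih =>
    intro R ε hε
    choose C hC using fun i => (φ i).exists_abs_value_le τ R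
    have hK : IsCompact (Set.pi Set.univ fun i => Set.Icc (-(C i)) (C i)) :=
      isCompact_univ_pi fun i => isCompact_Icc
    obtain ⟨η, hη, hfη⟩ := Metric.uniformContinuousOn_iff_le.mp
      (hK.uniformContinuousOn_of_continuous hf.continuousOn) ε hε
    choose δ hδ h using fun i => ih i R hη
    obtain ⟨δ₀, hδ₀, hle⟩ : ∃ δ₀ > 0, ∀ i, δ₀ ≤ δ i := by
      rcases isEmpty_or_nonempty (Fin k) with hk | hk
      · exact ⟨1, one_pos, fun i => (hk.false i).elim⟩
      · obtain ⟨i, hi⟩ := Finite.exists_min δ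
        exact ⟨δ i, hδ i, hi⟩
    refine ⟨δ₀, hδ₀, fun a b ha hb hab => ?_⟩
    refine hfη _ (fun i _ => abs_le.mp (hC i a ha)) _ (fun i _ => abs_le.mp (hC i b hb)) ?_
    exact (dist_pi_le_iff hη.le).mpr fun i => h i a b ha hb fun j => (hab j).trans (hle i)
  | sup r φ ih =>
    intro R ε hε
    obtain ⟨δ, hδ, h⟩ := ih (max R r) hε
    refine ⟨δ, hδ, fun a b ha hb hab => ?_⟩
    exact abs_ciSup_sub_ciSup_le (φ.bddAbove_value_cons τ r a) (φ.bddAbove_value_cons τ r b)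
      fun x => h _ _ (norm_cons_le ha (mem_closedBall_zero_iff.mp x.2))
        (norm_cons_le hb (mem_closedBall_zero_iff.mp x.2)) (cons_sub hδ hab x)
  | inf r φ ih =>
    intro R ε hε
    obtain ⟨δ, hδ, h⟩ := ih (max R r) hε
    refine ⟨δ, hδ, fun a b ha hb hab => ?_⟩
    exact abs_ciInf_sub_ciInf_le (φ.bddBelow_value_cons τ r a) (φ.bddBelow_value_cons τ r b)
      fun x => h _ _ (norm_cons_le ha (mem_closedBall_zero_iff.mp x.2))
        (norm_cons_le hb (mem_closedBall_zero_iff.mp x.2)) (cons_sub hδ hab x)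

variable {B : Type v} [CStarAlgebra B] (ρ : B ≃⋆ₐ[ℂ] B)

theorem CTerm.eval_starAlgEquiv (e : A ≃⋆ₐ[ℂ] B) (he : ∀ x, e (τ x) = ρ (e x)) {n : ℕ}
    (t : CTerm n) (a : Fin n → A) : t.eval ρ (fun i => e (a i)) = e (t.eval τ a) := by
  induction t with
  | var i => rfl
  | zero => simp [CTerm.eval]
  | one => simp [CTerm.eval]
  | add s t hs ht => simp [CTerm.eval, hs, ht]
  | mul s t hs ht => simp [CTerm.eval, hs, ht]
  | smul c t ht => simp [CTerm.eval, ht]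
  | star t ht => simp [CTerm.eval, ht, map_star]
  | aut t ht => simp [CTerm.eval, ht, he]

theorem CFormula.value_starAlgEquiv (e : A ≃⋆ₐ[ℂ] B) (he : ∀ x, e (τ x) = ρ (e x)) {n : ℕ}
    (φ : CFormula n) : ∀ a : Fin n → A, φ.value ρ (fun i => e (a i)) = φ.value τ a := by
  have hball : ∀ r : ℕ, ∃ E : Metric.closedBall (0 : A) (r : ℝ) ≃ Metric.closedBall (0 : B) (r : ℝ),
      ∀ x, (E x : B) = e x := fun r =>
    ⟨e.toEquiv.subtypeEquiv fun x => by
      rw [mem_closedBall_zero_iff, mem_closedBall_zero_iff]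
      exact (NonUnitalStarAlgHom.norm_map e (EquivLike.injective e) x).symm ▸ Iff.rfl, fun x => rfl⟩
  have hcons : ∀ {n : ℕ} (a : Fin n → A) (x : A),
      Fin.cons (α := fun _ => B) (e x) (fun i => e (a i)) =
        fun i => e (Fin.cons (α := fun _ => A) x a i) := by
    intro n a x
    funext i
    refine Fin.cases ?_ (fun j => ?_) i <;> simp
  induction φ with
  | norm t =>
    intro a
    rw [CFormula.value, CFormula.value, t.eval_starAlgEquiv τ ρ e he]
    exact NonUnitalStarAlgHom.norm_map e (EquivLike.injective e) _
  | conn f hf φ ih => intro a; simp only [CFormula.value, ih]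
  | sup r φ ih =>
    intro a
    obtain ⟨E, hE⟩ := hball r
    rw [CFormula.value, CFormula.value]
    refine (Equiv.iSup_congr E fun x => ?_).symm
    rw [hE, hcons, ih]
  | inf r φ ih =>
    intro a
    obtain ⟨E, hE⟩ := hball r
    rw [CFormula.value, CFormula.value]
    refine (Equiv.iInf_congr E fun x => ?_).symm
    rw [hE, hcons, ih]

/-- The theory of a structure determines the values of all sentences, not just which of them are
`0`. -/
theorem IsModelOf.value_eq {τ : A ≃⋆ₐ[ℂ] A} {ρ : B ≃⋆ₐ[ℂ] B} (h : IsModelOf ρ (theoryOf τ))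
    (φ : CSentence) : φ.value ρ Fin.elim0 = φ.value τ Fin.elim0 := by
  have hφ : φ.comp (fun v => v - φ.value τ Fin.elim0) (by fun_prop) ∈ theoryOf τ :=
    sub_self (φ.value τ Fin.elim0)
  exact sub_eq_zero.mp (h _ hφ)

end Semantics

/-! ### Combinatorics of the spirals -/

instance Spiral.instFinite (n : ℕ) : Finite (Spiral n) := by
  have : NeZero n.factorial := ⟨n.factorial_ne_zero⟩
  refine Finite.of_surjective
    (α := ZMod n.factorial ⊕ {k : ℤ // k ∈ Set.Ioo (-(n : ℤ)) n} ⊕ ZMod n.factorial)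
    (fun x => match x with
      | .inl k => .left k
      | .inr (.inl k) => .mid k.1 (abs_lt.mpr k.2)
      | .inr (.inr k) => .right k) ?_
  rintro (k | ⟨k, hk⟩ | k)
  · exact ⟨.inl k, rfl⟩
  · exact ⟨.inr (.inl ⟨k, abs_lt.mp hk⟩), rfl⟩
  · exact ⟨.inr (.inr k), rfl⟩

instance : Finite XiKind :=
  Finite.of_surjective (fun i : Fin 3 => ![XiKind.L, XiKind.M, XiKind.G] i) fun x => by
    cases x
    exacts [⟨0, rfl⟩, ⟨1, rfl⟩, ⟨2, rfl⟩]

instance (n : ℕ) : Finite (SpiralUnion n) := inferInstanceAs (Finite (_ × _))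

namespace Spiral

theorem exists_rel {n : ℕ} (x : Spiral n) : ∃ y, Rel n x y := by
  rcases x with k | ⟨k, hk⟩ | k
  · exact ⟨_, .left k⟩
  · have hk' := abs_lt.mp hk
    rcases lt_or_ge (k + 1) n with h | h
    · exact ⟨_, .mid k hk (abs_lt.mpr ⟨by omega, h⟩)⟩
    · have h1 : k = n - 1 := by omega
      subst h1
      exact ⟨_, .exit hk⟩
  · exact ⟨_, .right k⟩

theorem exists_rel_left {n : ℕ} (y : Spiral n) : ∃ x, Rel n x y := by
  rcases y with k | ⟨k, hk⟩ | k
  · exact ⟨.left (k - 1), by simpa using Rel.left (n := n) (k - 1)⟩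
  · have hk' := abs_lt.mp hk
    rcases lt_or_ge (-(n : ℤ)) (k - 1) with h | h
    · have := Rel.mid (n := n) (k - 1) (abs_lt.mpr ⟨h, by omega⟩) (by simpa using hk)
      exact ⟨_, by simpa using this⟩
    · have h1 : k = -n + 1 := by omega
      subst h1
      exact ⟨_, .enter hk⟩
  · exact ⟨.right (k - 1), by simpa using Rel.right (n := n) (k - 1)⟩

@[simp] theorem position_left (n : ℕ) (k) :
    position n (.left k) = factorialReduce n k := rfl
@[simp] theorem position_right (n : ℕ) (k) :
    position n (.right k) = factorialReduce n k := rfl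
@[simp] theorem position_mid (n : ℕ) (k : ℤ) (hk) :
    position n (.mid k hk) = (k : ZMod n.factorial) := rfl

theorem Rel.position {n : ℕ} {x y : Spiral (n + 1)} (h : Rel (n + 1) x y) :
    y.position n = x.position n + 1 := by
  cases h <;> simp

theorem factorialReduce_surjective (n : ℕ) : Function.Surjective (factorialReduce n) :=
  ZMod.castHom_surjective _

theorem Rel.xiL {n : ℕ} {x y : Spiral (n + 1)} (h : Rel (n + 1) x y) :
    Rel n (x.xiL n) (y.xiL n) := by
  rw [Spiral.xiL, Spiral.xiL, h.position]; exact .left _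

theorem Rel.xiG {n : ℕ} {x y : Spiral (n + 1)} (h : Rel (n + 1) x y) :
    Rel n (x.xiG n) (y.xiG n) := by
  rw [Spiral.xiG, Spiral.xiG, h.position]; exact .right _

theorem xiM_mid_of_lt {n : ℕ} {k : ℤ} (hk) (h : |k| < n) :
    xiM n (.mid k hk) = .mid k h := by simp [xiM, h]

theorem xiM_mid_neg {n : ℕ} (hn : 1 ≤ n) {k : ℤ} (hk) (h : k = -n) :
    xiM n (.mid k hk) = .left k := by
  subst h
  have : ¬ |(-n : ℤ)| < n := by simp
  have h' : (-n : ℤ) < 0 := by omega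
  simp only [xiM, dif_neg this, if_pos h']

theorem xiM_mid_pos {n : ℕ} {k : ℤ} (hk) (h : k = n) :
    xiM n (.mid k hk) = .right k := by
  subst h
  have : ¬ |(n : ℤ)| < n := by simp
  have h' : ¬ (n : ℤ) < 0 := by omega
  simp only [xiM, dif_neg this, if_neg h']

theorem Rel.xiM {n : ℕ} (hn : 1 ≤ n) {x y : Spiral (n + 1)} (h : Rel (n + 1) x y) :
    Rel n (x.xiM n) (y.xiM n) := by
  cases h with
  | left k => simpa [Spiral.xiM] using Rel.left (n := n) (factorialReduce n k)
  | right k => simpa [Spiral.xiM] using Rel.right (n := n) (factorialReduce n k)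
  | mid k hk hk' =>
    have h1 := abs_lt.mp hk
    have h2 := abs_lt.mp hk'
    push_cast at h1 h2
    rcases lt_or_ge (-(n : ℤ)) k with h | h
    · rw [xiM_mid_of_lt hk (abs_lt.mpr ⟨h, by omega⟩)]
      rcases lt_or_ge (k + 1) n with h' | h'
      · rw [xiM_mid_of_lt hk' (abs_lt.mpr ⟨by omega, h'⟩)]
        exact .mid k _ _
      · obtain rfl : k = n - 1 := by omega
        rw [xiM_mid_pos hk' (by omega)]
        simpa using Rel.exit (n := n) (abs_lt.mpr ⟨h, by omega⟩)
    · obtain rfl : k = -n := by omega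
      rw [xiM_mid_neg hn hk rfl, xiM_mid_of_lt hk' (abs_lt.mpr ⟨by omega, by omega⟩)]
      exact .enter _
  | enter h =>
    rw [xiM_mid_neg hn h (by push_cast; ring)]
    simpa [Spiral.xiM] using Rel.left (n := n) (-1 + -(n : ZMod n.factorial))
  | exit h =>
    rw [xiM_mid_pos h (by push_cast; ring)]
    simpa [Spiral.xiM] using Rel.right (n := n) (n : ZMod n.factorial)

theorem Rel.map {n : ℕ} (hn : 1 ≤ n) (a : XiKind) {x y : Spiral (n + 1)} (h : Rel (n + 1) x y) :
    Rel n (a.map n x) (a.map n y) := by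
  cases a
  exacts [h.xiL, h.xiM hn, h.xiG]

theorem xiM_surjective (n : ℕ) : Function.Surjective (xiM n) := by
  rintro (k | ⟨k, hk⟩ | k)
  · obtain ⟨l, rfl⟩ := factorialReduce_surjective n k
    exact ⟨.left l, rfl⟩
  · exact ⟨.mid k (hk.trans (by simp)), xiM_mid_of_lt _ hk⟩
  · obtain ⟨l, rfl⟩ := factorialReduce_surjective n k
    exact ⟨.right l, rfl⟩

/-- A point of a spiral with two successors is the point of the left cycle at which the middle
segment starts; its two successors have the same image one level below. -/
theorem Rel.map_eq {n : ℕ} (hn : 1 ≤ n) (a : XiKind) {x y y' : Spiral (n + 1)}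
    (h : Rel (n + 1) x y) (h' : Rel (n + 1) x y') : a.map n y = a.map n y' := by
  have key : ∀ h, a.map n (.left (((-((n + 1 : ℕ) : ℤ) : ℤ) : ZMod (n + 1).factorial) + 1)) =
      a.map n (.mid (-((n + 1 : ℕ) : ℤ) + 1) h) := by
    intro h
    cases a
    · simp [XiKind.map, Spiral.xiL]
    · rw [XiKind.map, xiM_mid_neg hn h (by push_cast; ring)]
      simp [Spiral.xiM]
    · simp [XiKind.map, Spiral.xiG]
  generalize hx : x = z at h'
  cases h with
  | left k =>
    cases h' with
    | left k' => cases hx; rfl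
    | enter h' => cases hx; exact key h'
    | _ => cases hx
  | right k =>
    cases h' with
    | right k' => cases hx; rfl
    | _ => cases hx
  | mid k hk hk' =>
    cases h' with
    | mid k' _ _ => cases hx; rfl
    | exit h' =>
      cases hx
      have := (abs_lt.mp hk').2
      omega
    | _ => cases hx
  | enter h =>
    cases h' with
    | left k' => cases hx; exact (key h).symm
    | enter h' => rfl
    | _ => cases hx
  | exit h =>
    cases h' with
    | mid k' _ hk' =>
      cases hx
      have := (abs_lt.mp hk').2
      omega
    | exit h' => rfl
    | _ => cases hx

end Spiral

namespace SpiralUnion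

theorem exists_rel {n : ℕ} (x : SpiralUnion n) : ∃ y, Rel n x y := by
  obtain ⟨y, hy⟩ := Spiral.exists_rel x.2
  exact ⟨(x.1, y), rfl, hy⟩

theorem exists_rel_left {n : ℕ} (y : SpiralUnion n) : ∃ x, Rel n x y := by
  obtain ⟨x, hx⟩ := Spiral.exists_rel_left y.2
  exact ⟨(y.1, x), rfl, hx⟩

theorem Rel.xi {n : ℕ} (hn : 1 ≤ n) {x y : SpiralUnion (n + 1)} (h : Rel (n + 1) x y) :
    Rel n (x.xi n) (y.xi n) := by
  obtain ⟨h1, h2⟩ := h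
  refine ⟨by rw [SpiralUnion.xi, SpiralUnion.xi, h1], ?_⟩
  simp only [SpiralUnion.xi, h1]
  exact h2.map hn _

theorem Rel.xi_eq {n : ℕ} (hn : 1 ≤ n) {x y y' : SpiralUnion (n + 1)} (h : Rel (n + 1) x y)
    (h' : Rel (n + 1) x y') : y.xi n = y'.xi n := by
  obtain ⟨h1, h2⟩ := h
  obtain ⟨h1', h2'⟩ := h'
  simp only [SpiralUnion.xi, ← h1, ← h1', h2.map_eq hn _ h2']

theorem xi_surjective (n : ℕ) : Function.Surjective (xi n) := by
  rintro ⟨w, s⟩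
  obtain ⟨s', rfl⟩ := Spiral.xiM_surjective n s
  refine ⟨(Fin.snoc (α := fun _ => XiLetter) w (.M, 0), s'), ?_⟩
  simp [xi, XiKind.map]

theorem Rel.xiIter {n : ℕ} (hn : 1 ≤ n) {k : ℕ} {x y : SpiralUnion (n + k)} (h : Rel (n + k) x y) :
    Rel n (xiIter n k x) (xiIter n k y) := by
  induction k with
  | zero => exact h
  | succ k ih => exact ih (Rel.xi (n := n + k) (by omega) h)

theorem Rel.xiIter_eq {n : ℕ} (hn : 1 ≤ n) {k : ℕ} (hk : 1 ≤ k) {x y y' : SpiralUnion (n + k)}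
    (h : Rel (n + k) x y) (h' : Rel (n + k) x y') :
    SpiralUnion.xiIter n k y = SpiralUnion.xiIter n k y' := by
  obtain ⟨k, rfl⟩ : ∃ j, k = j + 1 := ⟨k - 1, by omega⟩
  exact congrArg (SpiralUnion.xiIter n k) (Rel.xi_eq (n := n + k) (by omega) h h')

end SpiralUnion

theorem IsSpiralMap.xi {X : Type*} [TopologicalSpace X] {σ : X ≃ₜ X} {n : ℕ} (hn : 1 ≤ n)
    {φ : X → SpiralUnion (n + 1)} (h : IsSpiralMap σ φ) : IsSpiralMap σ (SpiralUnion.xi n ∘ φ) :=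
  ⟨h.locallyConstant.comp _, (SpiralUnion.xi_surjective n).comp h.surjective,
    fun x => (h.rel x).xi hn⟩

/-! ### Lifting spiral maps; back and forth -/

/-- Every map of `(K, r)` onto a spiral union lifts to maps onto higher spiral unions whose fibres
are small in the sense of any given member of `𝒱`. For `𝒱` the uniformity of `K` this is the second
half of the lifting property; for `𝒱 = {univ}` there is no condition on the fibres. -/
def LiftsFinely {K : Type*} [TopologicalSpace K] (r : K ≃ₜ K) (𝒱 : Set (Set (K × K))) : Prop :=
  ∀ n : ℕ, 1 ≤ n → ∀ θ : K → SpiralUnion n, IsSpiralMap r θ → ∀ V ∈ 𝒱,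
    ∃ k : ℕ, 1 ≤ k ∧ ∃ θ' : K → SpiralUnion (n + k), IsSpiralMap r θ' ∧
      (∀ x y, θ' x = θ' y → (x, y) ∈ V) ∧ θ = SpiralUnion.xiIter n k ∘ θ'

section

variable {X : Type*} [TopologicalSpace X] {σ : X ≃ₜ X} {𝒱 : Set (Set (X × X))}
  {K : Type*} [TopologicalSpace K] {r : K ≃ₜ K} {𝒲 : Set (Set (K × K))}

theorem LiftsFinely.exists_lift_succ (h : LiftsFinely r 𝒲) (hne : 𝒲.Nonempty) {n : ℕ} (hn : 1 ≤ n)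
    {θ : K → SpiralUnion n} (hθ : IsSpiralMap r θ) :
    ∃ θ' : K → SpiralUnion (n + 1), IsSpiralMap r θ' ∧ θ = SpiralUnion.xi n ∘ θ' := by
  obtain ⟨V, hV⟩ := hne
  obtain ⟨k, hk, θ', hθ', -, rfl⟩ := h n hn θ hθ V hV
  induction k, hk using Nat.le_induction with
  | base => exact ⟨θ', hθ', rfl⟩
  | succ k hk ih => exact ih _ (IsSpiralMap.xi (n := n + k) (by omega) hθ') hθ

theorem LiftsFinely.exists_lift (h : LiftsFinely r 𝒲) (hne : 𝒲.Nonempty) {n : ℕ} (hn : 1 ≤ n)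
    {θ : K → SpiralUnion n} (hθ : IsSpiralMap r θ) (k : ℕ) :
    ∃ θ' : K → SpiralUnion (n + k), IsSpiralMap r θ' ∧ θ = SpiralUnion.xiIter n k ∘ θ' := by
  induction k with
  | zero => exact ⟨θ, hθ, rfl⟩
  | succ k ih =>
    obtain ⟨θ₁, h₁, e₁⟩ := ih
    obtain ⟨θ₂, h₂, e₂⟩ := h.exists_lift_succ hne (n := n + k) (by omega) h₁
    exact ⟨θ₂, h₂, by rw [e₁, e₂]; rfl⟩

variable (σ r) in
/-- A pair of maps of `(X, σ)` and of `(K, r)` onto the same spiral union. -/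
structure SpiralMapPair where
  n : ℕ
  one_le : 1 ≤ n
  φ : X → SpiralUnion n
  θ : K → SpiralUnion n
  isSpiralMap_φ : IsSpiralMap σ φ
  isSpiralMap_θ : IsSpiralMap r θ

/-- The pair `T` lifts the pair `S` along one map, which sends all successors of a point to the same
point. -/
def SpiralMapPair.Lifts (S T : SpiralMapPair σ r) : Prop :=
  ∃ f : SpiralUnion T.n → SpiralUnion S.n, S.φ = f ∘ T.φ ∧ S.θ = f ∘ T.θ ∧
    ∀ x y y', SpiralUnion.Rel T.n x y → SpiralUnion.Rel T.n x y' → f y = f y'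

theorem SpiralMapPair.exists_lifts (hσ : LiftsFinely σ 𝒱) (hr : LiftsFinely r 𝒲)
    (S : SpiralMapPair σ r) {V : Set (X × X)} (hV : V ∈ 𝒱) {V' : Set (K × K)} (hV' : V' ∈ 𝒲) :
    ∃ T : SpiralMapPair σ r, S.Lifts T ∧ (∀ x y, T.φ x = T.φ y → (x, y) ∈ V) ∧
      ∀ x y, T.θ x = T.θ y → (x, y) ∈ V' := by
  obtain ⟨n, hn, φ, θ, hφ, hθ⟩ := S
  -- A fine lift on one side is matched by some lift to the same level on the other side, in turn.
  obtain ⟨k, hk, φ₁, hφ₁, hφ₁V, eφ₁⟩ := hσ n hn φ hφ V hV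
  obtain ⟨θ₁, hθ₁, eθ₁⟩ := hr.exists_lift ⟨V', hV'⟩ hn hθ k
  obtain ⟨l, -, θ₂, hθ₂, hθ₂V, eθ₂⟩ := hr (n + k) (by omega) θ₁ hθ₁ V' hV'
  obtain ⟨φ₂, hφ₂, eφ₂⟩ := hσ.exists_lift ⟨V, hV⟩ (by omega) hφ₁ l
  refine ⟨⟨n + k + l, by omega, φ₂, θ₂, hφ₂, hθ₂⟩,
    ⟨SpiralUnion.xiIter n k ∘ SpiralUnion.xiIter (n + k) l, ?_, ?_, ?_⟩, ?_, hθ₂V⟩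
  · rw [Function.comp_assoc, ← eφ₂, ← eφ₁]
  · rw [Function.comp_assoc, ← eθ₂, ← eθ₁]
  · exact fun x y y' h h' => SpiralUnion.Rel.xiIter_eq hn hk
      (x := SpiralUnion.xiIter (n + k) l x) (h.xiIter (by omega)) (h'.xiIter (by omega))
  · intro x y hxy
    refine hφ₁V x y ?_
    simp only at hxy
    rw [eφ₂, Function.comp_apply, hxy, Function.comp_apply]

theorem SpiralMapPair.exists_seq (hσ : LiftsFinely σ 𝒱) (hr : LiftsFinely r 𝒲)
    (S₀ : SpiralMapPair σ r) {V : ℕ → Set (X × X)} (hV : ∀ i, V i ∈ 𝒱) {V' : ℕ → Set (K × K)}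
    (hV' : ∀ i, V' i ∈ 𝒲) :
    ∃ S : ℕ → SpiralMapPair σ r, S 0 = S₀ ∧ ∀ i, (S i).Lifts (S (i + 1)) ∧
      (∀ x y, (S (i + 1)).φ x = (S (i + 1)).φ y → (x, y) ∈ V i) ∧
      ∀ x y, (S (i + 1)).θ x = (S (i + 1)).θ y → (x, y) ∈ V' i := by
  choose F hF using fun (i : ℕ) (S : SpiralMapPair σ r) => S.exists_lifts hσ hr (hV i) (hV' i)
  exact ⟨fun i => Nat.rec S₀ F i, rfl, fun i => hF i _⟩

end

/-- If the maps `φ i` separate the points of `X` uniformly, then a compatible sequence of maps `θ i`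
on `K` with the same targets comes from a continuous equivariant map `K → X`. -/
theorem exists_limit_map {X : Type*} [UniformSpace X] [CompactSpace X] [T0Space X] (σ : X ≃ₜ X)
    {K : Type*} [TopologicalSpace K] (r : K ≃ₜ K) {W : ℕ → Type*} (R : ∀ i, W i → W i → Prop)
    (f : ∀ i, W (i + 1) → W i)
    (hf : ∀ i x y y', R (i + 1) x y → R (i + 1) x y' → f i y = f i y')
    (φ : ∀ i, X → W i) (hφ : ∀ i, IsLocallyConstant (φ i)) (hφs : ∀ i, Function.Surjective (φ i))
    (hφR : ∀ i x, R i (φ i x) (φ i (σ x))) (hφf : ∀ i, φ i = f i ∘ φ (i + 1))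
    (hfine : ∀ V ∈ 𝓤 X, ∃ i, ∀ x y, φ i x = φ i y → (x, y) ∈ V)
    (θ : ∀ i, K → W i) (hθ : ∀ i, IsLocallyConstant (θ i))
    (hθR : ∀ i t, R i (θ i t) (θ i (r t))) (hθf : ∀ i, θ i = f i ∘ θ (i + 1)) :
    ∃ π : C(K, X), (∀ i t, φ i (π t) = θ i t) ∧ ∀ t, π (r t) = σ (π t) := by
  have hsep : ∀ x y, (∀ i, φ i x = φ i y) → x = y := fun x y h =>
    eq_of_uniformity fun {V} hV => by
      obtain ⟨i, hi⟩ := hfine V hV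
      exact hi x y (h i)
  have hex : ∀ t, ∃ x, ∀ i, φ i x = θ i t := by
    intro t
    have hclosed : ∀ i, IsClosed (φ i ⁻¹' {θ i t}) := fun i => ((hφ i).isClosed_fiber _)
    obtain ⟨x, hx⟩ := IsCompact.nonempty_iInter_of_sequence_nonempty_isCompact_isClosed
      (fun i => φ i ⁻¹' {θ i t})
      (fun i x hx => by
        simp only [mem_preimage, mem_singleton_iff] at hx ⊢
        rw [hφf, hθf, Function.comp_apply, Function.comp_apply, hx])
      (fun i => (hφs i (θ i t)).imp fun x hx => hx) (hclosed 0).isCompact hclosed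
    exact ⟨x, fun i => by simpa using mem_iInter.mp hx i⟩
  choose π hπ using hex
  have hcont : Continuous π := by
    refine continuous_iff_continuousAt.mpr fun t => Uniform.continuousAt_iff'_right.mpr ?_
    intro V hV
    obtain ⟨i, hi⟩ := hfine V hV
    rw [Filter.mem_map]
    filter_upwards [(hθ i).eventually_eq t] with s hs
    exact hi _ _ (by rw [hπ, hπ, hs])
  refine ⟨⟨π, hcont⟩, fun i t => hπ t i, fun t => hsep _ _ fun i => ?_⟩
  change φ i (π (r t)) = φ i (σ (π t))
  rw [hπ, hθf, hφf]
  refine hf i (θ (i + 1) t) _ _ (hθR _ t) ?_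
  rw [← hπ]
  exact hφR _ _

theorem HasLiftingProperty.liftsFinely {X : Type*} [UniformSpace X] {σ : X ≃ₜ X}
    (hσ : HasLiftingProperty σ) : LiftsFinely σ {V | V ∈ 𝓤 X} := hσ.2

section

variable {X : Type*} [UniformSpace X] [CompactSpace X] [T0Space X] [(𝓤 X).IsCountablyGenerated]
  {σ : X ≃ₜ X}

/-- Two maps of `(X, σ)` and of `(K, r)` onto the same spiral union are intertwined by a continuous
equivariant map `K → X`. It is the limit of a sequence of pairs of lifts of the two maps; the fibres
of the lifts shrink to points on `X`, and they are controlled by the given sets `V' i` on `K`. -/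
theorem exists_intertwining (hσ : HasLiftingProperty σ) {K : Type*} [TopologicalSpace K]
    {r : K ≃ₜ K} {𝒲 : Set (Set (K × K))} (hr : LiftsFinely r 𝒲) {V' : ℕ → Set (K × K)}
    (hV' : ∀ i, V' i ∈ 𝒲) {n : ℕ} (hn : 1 ≤ n)
    {φ : X → SpiralUnion n} (hφ : IsSpiralMap σ φ) {θ : K → SpiralUnion n} (hθ : IsSpiralMap r θ) :
    ∃ S : ℕ → SpiralMapPair σ r, ∃ π : C(K, X), (∀ t, φ (π t) = θ t) ∧
      (∀ i t, (S i).φ (π t) = (S i).θ t) ∧ (∀ t, π (r t) = σ (π t)) ∧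
      (∀ V ∈ 𝓤 X, ∃ i, ∀ x y, (S i).φ x = (S i).φ y → (x, y) ∈ V) ∧
      ∀ i x y, (S (i + 1)).θ x = (S (i + 1)).θ y → (x, y) ∈ V' i := by
  obtain ⟨V, hV⟩ := (𝓤 X).exists_antitone_basis
  obtain ⟨S, hS₀, hS⟩ := SpiralMapPair.exists_seq hσ.liftsFinely hr ⟨n, hn, φ, θ, hφ, hθ⟩
    (fun i => hV.mem i) hV'
  choose f hfφ hfθ hf using fun i => (hS i).1
  have hfine : ∀ U ∈ 𝓤 X, ∃ i, ∀ x y, (S i).φ x = (S i).φ y → (x, y) ∈ U := by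
    intro U hU
    obtain ⟨i, hi⟩ := hV.mem_iff.mp hU
    exact ⟨i + 1, fun x y h => hi ((hS i).2.1 x y h)⟩
  obtain ⟨π, hπ, hπ'⟩ := exists_limit_map σ r (fun i => SpiralUnion.Rel (S i).n) f hf
    (fun i => (S i).φ) (fun i => (S i).isSpiralMap_φ.locallyConstant)
    (fun i => (S i).isSpiralMap_φ.surjective) (fun i => (S i).isSpiralMap_φ.rel) hfφ hfine
    (fun i => (S i).θ) (fun i => (S i).isSpiralMap_θ.locallyConstant)
    (fun i => (S i).isSpiralMap_θ.rel) hfθ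
  have h0 := hπ 0
  rw [hS₀] at h0
  exact ⟨S, π, h0, hπ, hπ', hfine, fun i => (hS i).2.2⟩

/-- Any two maps of `(X, σ)` onto the same spiral union differ by a symmetry of `(X, σ)`, if `σ` has
the lifting property. -/
theorem HasLiftingProperty.exists_homeomorph (hσ : HasLiftingProperty σ) {n : ℕ} (hn : 1 ≤ n)
    {φ φ' : X → SpiralUnion n} (hφ : IsSpiralMap σ φ) (hφ' : IsSpiralMap σ φ') :
    ∃ h : X ≃ₜ X, (∀ x, h (σ x) = σ (h x)) ∧ ∀ x, φ (h x) = φ' x := by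
  obtain ⟨V, hV⟩ := (𝓤 X).exists_antitone_basis
  obtain ⟨S, π, h0, hπ, hπ', hfine, hfine'⟩ :=
    exists_intertwining hσ hσ.liftsFinely (fun i => hV.mem i) hn hφ hφ'
  have : T2Space X := inferInstance
  have hinj : Function.Injective π := by
    intro x y hxy
    refine eq_of_uniformity fun {U} hU => ?_
    obtain ⟨i, hi⟩ := hV.mem_iff.mp hU
    exact hi (hfine' i x y (by rw [← hπ, ← hπ, hxy]))
  have hsurj : Function.Surjective π := by
    have hdense : DenseRange π := by
      intro x
      rw [UniformSpace.mem_closure_iff_ball]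
      intro U hU
      obtain ⟨i, hi⟩ := hfine U hU
      obtain ⟨t, ht⟩ := (S i).isSpiralMap_θ.surjective ((S i).φ x)
      exact ⟨π t, hi _ _ (by rw [hπ, ht]), t, rfl⟩
    have := (isCompact_range π.continuous).isClosed.closure_eq ▸ hdense.closure_range
    exact range_eq_univ.mp this
  exact ⟨π.continuous.homeoOfEquivCompactToT2 (f := Equiv.ofBijective π ⟨hinj, hsurj⟩),
    hπ', h0⟩

end

/-! ### Indicator tuples of partitions and their stability -/

/-- A sentence expressing the supremum of `φ` over all tuples in the unit ball. -/
def CFormula.supAll {N : ℕ} (φ : CFormula N) : CSentence :=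
  CFormula.supBlock 1 N (φ.subst fun i => .var (blockFst i))

/-- A sentence expressing the infimum of `φ` over all tuples in the unit ball. -/
def CFormula.infAll {N : ℕ} (φ : CFormula N) : CSentence :=
  CFormula.infBlock 1 N (φ.subst fun i => .var (blockFst i))

section

variable {A : Type u} [CStarAlgebra A] (τ : A ≃⋆ₐ[ℂ] A)

theorem CFormula.value_subst_blockFst {n N : ℕ} (φ : CFormula N) (b : Fin N → A) (a : Fin n → A) :
    (φ.subst fun i => .var (blockFst i)).value τ (blockTuple b a) = φ.value τ b := by
  rw [CFormula.value_subst]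
  simp only [CTerm.eval, blockTuple_fst]

theorem CFormula.value_supAll_le_iff {N : ℕ} (φ : CFormula N) (c : ℝ) :
    φ.supAll.value τ Fin.elim0 ≤ c ↔ ∀ b : Fin N → A, (∀ i, ‖b i‖ ≤ 1) → φ.value τ b ≤ c := by
  rw [CFormula.supAll, CFormula.value_supBlock_le_iff]
  simp only [CFormula.value_subst_blockFst, Nat.cast_one]

theorem CFormula.value_infAll_lt_iff {N : ℕ} (φ : CFormula N) (c : ℝ) :
    φ.infAll.value τ Fin.elim0 < c ↔ ∃ b : Fin N → A, (∀ i, ‖b i‖ ≤ 1) ∧ φ.value τ b < c := by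
  rw [CFormula.infAll, CFormula.value_infBlock_lt_iff]
  simp only [CFormula.value_subst_blockFst, Nat.cast_one]

end

section

variable {W : Type*} [Finite W]

open Classical in
/-- The summands of `defectFormula`: they ask that each `x_w` is idempotent and of norm `1`, that
the `x_w` sum up to `1`, and that `x_v` vanishes at the image of the support of `x_w`
unless `R w v`. -/
noncomputable def defectSummand (R : W → W → Prop) :
    Fin (Nat.card W) ⊕ Fin (Nat.card W) ⊕ Unit ⊕ Fin (Nat.card W) × Fin (Nat.card W) →
      CFormula (Nat.card W)
  | .inl i => .norm (.sub (.mul (.var i) (.var i)) (.var i))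
  | .inr (.inl i) => .comp (fun v => |v - 1|) (by fun_prop) (.norm (.var i))
  | .inr (.inr (.inl _)) => .norm (.sub (.sum Finset.univ .var) .one)
  | .inr (.inr (.inr p)) =>
    if R ((Finite.equivFin W).symm p.1) ((Finite.equivFin W).symm p.2) then .norm .zero
    else .norm (.mul (.var p.1) (.aut (.var p.2)))

/-- The defect of a tuple `(x_w)_{w ∈ W}`, which measures how far it is from consisting of the
indicator functions of the fibres of a surjection onto `W` under which the automorphism moves
points along `R`. -/
noncomputable def defectFormula (R : W → W → Prop) : CFormula (Nat.card W) :=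
  CFormula.sum (defectSummand R)

variable {K : Type*} [TopologicalSpace K]

/-- The continuous function `g ∘ θ` for a locally constant `θ`. -/
def pullback {θ : K → W} (hθ : IsLocallyConstant θ) (g : W → ℂ) : C(K, ℂ) :=
  ⟨g ∘ θ, (hθ.comp g).continuous⟩

open Classical in
/-- The indicator functions of the fibres of a locally constant map, in the order given by
`Finite.equivFin W`. -/
noncomputable def indTuple {θ : K → W} (hθ : IsLocallyConstant θ) (i : Fin (Nat.card W)) :
    C(K, ℂ) :=
  pullback hθ fun w => if w = (Finite.equivFin W).symm i then 1 else 0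

open Classical in
theorem indTuple_apply {θ : K → W} (hθ : IsLocallyConstant θ) (i : Fin (Nat.card W)) (t : K) :
    indTuple hθ i t = if θ t = (Finite.equivFin W).symm i then 1 else 0 := rfl

variable [CompactSpace K]

theorem norm_indTuple_le {θ : K → W} (hθ : IsLocallyConstant θ) (i : Fin (Nat.card W)) :
    ‖indTuple hθ i‖ ≤ 1 := by
  refine (ContinuousMap.norm_le _ zero_le_one).mpr fun t => ?_
  rw [indTuple_apply]
  split_ifs <;> simp

/-- The automorphism `f ↦ f ∘ r` of `C(K)`. -/
noncomputable abbrev koopman (r : K ≃ₜ K) : C(K, ℂ) ≃⋆ₐ[ℂ] C(K, ℂ) := r.compStarAlgEquiv' ℂ ℂ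

omit [CompactSpace K] in
theorem koopman_apply (r : K ≃ₜ K) (f : C(K, ℂ)) (t : K) : koopman r f t = f (r t) := rfl

theorem value_defectFormula_indTuple (r : K ≃ₜ K) {R : W → W → Prop} {θ : K → W}
    (hθ : IsLocallyConstant θ) (hs : Function.Surjective θ) (hR : ∀ t, R (θ t) (θ (r t))) :
    (defectFormula R).value (koopman r) (indTuple hθ) = 0 := by
  rw [defectFormula, CFormula.value_sum]
  refine Finset.sum_eq_zero fun j _ => ?_
  rcases j with i | i | i | ⟨i, j⟩
  · simp only [defectSummand, CFormula.value, CTerm.eval_sub, CTerm.eval]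
    rw [norm_eq_zero]
    ext t
    by_cases h : θ t = (Finite.equivFin W).symm i <;> simp [indTuple_apply, h]
  · simp only [defectSummand, CFormula.value_comp, CFormula.value, CTerm.eval]
    obtain ⟨t, ht⟩ := hs ((Finite.equivFin W).symm i)
    have h1 : ‖indTuple hθ i t‖ = 1 := by simp [indTuple_apply, ht]
    have h2 := ContinuousMap.norm_coe_le_norm (indTuple hθ i) t
    rw [le_antisymm (norm_indTuple_le hθ i) (h1 ▸ h2)]
    simp
  · simp only [defectSummand, CFormula.value, CTerm.eval_sub, CTerm.eval_sum, CTerm.eval]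
    rw [norm_eq_zero]
    ext t
    simp only [ContinuousMap.sub_apply, ContinuousMap.one_apply, ContinuousMap.sum_apply,
      ContinuousMap.zero_apply, indTuple_apply, Equiv.eq_symm_apply]
    simp
  · simp only [defectSummand]
    split_ifs with h
    · simp [CFormula.value, CTerm.eval]
    · simp only [CFormula.value, CTerm.eval]
      rw [norm_eq_zero]
      ext t
      by_cases h1 : θ t = (Finite.equivFin W).symm i
      · have h2 : ¬ θ (r t) = (Finite.equivFin W).symm j := fun h2 => h (h1 ▸ h2 ▸ hR t)
        simp [indTuple_apply, h2]
      · simp [indTuple_apply, h1]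

theorem value_defectSummand_nonneg (r : K ≃ₜ K) (R : W → W → Prop)
    (x : Fin (Nat.card W) → C(K, ℂ)) (j) : 0 ≤ (defectSummand R j).value (koopman r) x := by
  rcases j with i | i | i | ⟨i, j⟩
  · exact norm_nonneg _
  · exact abs_nonneg _
  · exact norm_nonneg _
  · simp only [defectSummand]
    split_ifs
    exacts [norm_nonneg _, norm_nonneg _]

theorem value_defectSummand_le (r : K ≃ₜ K) (R : W → W → Prop)
    (x : Fin (Nat.card W) → C(K, ℂ)) (j) :
    (defectSummand R j).value (koopman r) x ≤ (defectFormula R).value (koopman r) x := by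
  rw [defectFormula, CFormula.value_sum]
  exact Finset.single_le_sum (f := fun j => (defectSummand R j).value (koopman r) x)
    (fun j _ => value_defectSummand_nonneg r R x j) (Finset.mem_univ j)

theorem value_defectFormula_nonneg (r : K ≃ₜ K) (R : W → W → Prop)
    (x : Fin (Nat.card W) → C(K, ℂ)) : 0 ≤ (defectFormula R).value (koopman r) x := by
  rw [defectFormula, CFormula.value_sum]
  exact Finset.sum_nonneg fun j _ => value_defectSummand_nonneg r R x j

/-- A complex number that is almost idempotent is close to `0` or to `1`. -/
theorem norm_le_or_norm_sub_one_le {z : ℂ} {δ : ℝ} (hz : ‖z * z - z‖ ≤ δ) :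
    ‖z‖ ≤ 2 * δ ∨ ‖z - 1‖ ≤ 2 * δ := by
  have h1 : ‖z‖ * ‖z - 1‖ ≤ δ := by
    rw [← norm_mul]; convert hz using 2; ring
  have h2 : 1 ≤ ‖z‖ + ‖z - 1‖ := by
    calc (1 : ℝ) = ‖z - (z - 1)‖ := by simp
      _ ≤ _ := norm_sub_le _ _
  by_contra! h
  rcases le_total ‖z‖ (1 / 2) with h3 | h3
  · nlinarith [norm_nonneg z, h.1, h.2]
  · nlinarith [norm_nonneg (z - 1), h.1, h.2]

/-- Stability of the relations in `defectFormula`: a tuple of small defect is close to the tuple of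
indicator functions of the fibres of an actual surjection. -/
theorem exists_norm_sub_indTuple_le (r : K ≃ₜ K) {R : W → W → Prop}
    {x : Fin (Nat.card W) → C(K, ℂ)} {δ : ℝ} (hδ : δ ≤ 1 / 8)
    (hδN : δ * (2 * Nat.card W + 1) < 1)
    (hx : (defectFormula R).value (koopman r) x ≤ δ) :
    ∃ (θ : K → W) (hθ : IsLocallyConstant θ), Function.Surjective θ ∧
      (∀ t, R (θ t) (θ (r t))) ∧ ∀ i, ‖x i - indTuple hθ i‖ ≤ 2 * δ := by
  have hδ0 : 0 ≤ δ := (value_defectFormula_nonneg r R x).trans hx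
  have hat : ∀ j, (defectSummand R j).value (koopman r) x ≤ δ :=
    fun j => (value_defectSummand_le r R x j).trans hx
  have h01 : ∀ i t, ‖x i t‖ ≤ 2 * δ ∨ ‖x i t - 1‖ ≤ 2 * δ := by
    intro i t
    refine norm_le_or_norm_sub_one_le ?_
    have := hat (.inl i)
    simp only [defectSummand, CFormula.value, CTerm.eval_sub, CTerm.eval] at this
    exact (ContinuousMap.norm_coe_le_norm (x i * x i - x i) t).trans this
  have hsum : ∀ t, ‖∑ i, x i t - 1‖ ≤ δ := by
    intro t
    have := hat (.inr (.inr (.inl ())))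
    simp only [defectSummand, CFormula.value, CTerm.eval_sub, CTerm.eval, CTerm.eval_sum] at this
    have h := (ContinuousMap.norm_coe_le_norm (∑ i, x i - 1) t).trans this
    simpa using h
  have hnorm : ∀ i, 1 - δ ≤ ‖x i‖ := by
    intro i
    have := hat (.inr (.inl i))
    simp only [defectSummand, CFormula.value_comp, CFormula.value, CTerm.eval] at this
    linarith [(abs_le.mp this).1]
  have hrel : ∀ i j t, ¬ R ((Finite.equivFin W).symm i) ((Finite.equivFin W).symm j) →
      ‖x i t‖ * ‖x j (r t)‖ ≤ δ := by
    intro i j t hij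
    have := hat (.inr (.inr (.inr (i, j))))
    simp only [defectSummand, if_neg hij, CFormula.value, CTerm.eval] at this
    rw [← norm_mul]
    exact (ContinuousMap.norm_coe_le_norm (x i * koopman r (x j)) t).trans this
  have hexcl : ∀ z : ℂ, ‖z - 1‖ ≤ 2 * δ → 1 - 2 * δ ≤ ‖z‖ := by
    intro z hz
    have : ‖(1 : ℂ)‖ ≤ ‖z‖ + ‖z - 1‖ := by
      calc _ = ‖z - (z - 1)‖ := by simp
        _ ≤ _ := norm_sub_le _ _
    rw [norm_one] at this
    linarith
  -- At each point exactly one of the functions is close to `1`, as they sum up to almost `1`.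
  have hcard : ∀ t, ∃ i, ∀ j, ‖x j t - 1‖ ≤ 2 * δ ↔ j = i := by
    intro t
    classical
    set S : Finset (Fin (Nat.card W)) := Finset.univ.filter fun i => ‖x i t - 1‖ ≤ 2 * δ with hS
    have h1 : ‖∑ i, (x i t - if i ∈ S then 1 else 0)‖ ≤ Nat.card W * (2 * δ) := by
      refine (norm_sum_le _ _).trans ?_
      have : ∀ i ∈ Finset.univ, ‖x i t - if i ∈ S then 1 else 0‖ ≤ 2 * δ := by
        intro i _
        by_cases hi : ‖x i t - 1‖ ≤ 2 * δ
        · simp [hS, hi]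
        · simpa [hS, hi] using (h01 i t).resolve_right hi
      refine (Finset.sum_le_sum this).trans ?_
      simp
    rw [Finset.sum_sub_distrib] at h1
    have h2 : ∑ i, (if i ∈ S then (1 : ℂ) else 0) = (S.card : ℂ) := by simp
    rw [h2] at h1
    have h3 : ‖((S.card : ℤ) - 1 : ℂ)‖ < 1 := by
      calc ‖((S.card : ℤ) - 1 : ℂ)‖ = ‖(∑ i, x i t - 1) - (∑ i, x i t - (S.card : ℂ))‖ := by
            congr 1; push_cast; ring
        _ ≤ δ + Nat.card W * (2 * δ) := (norm_sub_le _ _).trans (add_le_add (hsum t) h1)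
        _ < 1 := by linarith
    have h4 : |((S.card : ℤ) - 1)| < 1 := by
      have : ((S.card : ℤ) - 1 : ℂ) = (((S.card : ℤ) - 1 : ℤ) : ℂ) := by push_cast; ring
      rw [this, Complex.norm_intCast] at h3
      exact_mod_cast h3
    have h5 : S.card = 1 := by have := Int.abs_lt_one_iff.mp h4; omega
    obtain ⟨i, hi⟩ := Finset.card_eq_one.mp h5
    refine ⟨i, fun j => ?_⟩
    rw [← Finset.mem_singleton, ← hi, hS]
    simp
  choose ι hι using hcard
  have hι1 : ∀ t, ‖x (ι t) t - 1‖ ≤ 2 * δ := fun t => (hι t _).mpr rfl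
  have hloc : IsLocallyConstant fun t => (Finite.equivFin W).symm (ι t) := by
    refine IsLocallyConstant.comp (f := ι) ((IsLocallyConstant.iff_isOpen_fiber).mpr fun i => ?_) _
    have : ι ⁻¹' {i} = {t | ‖x i t - 1‖ < 1 / 2} := by
      ext t
      simp only [mem_preimage, mem_singleton_iff, mem_ofPred_eq]
      rw [eq_comm, ← hι t]
      refine ⟨fun h => by linarith, fun h => (h01 i t).resolve_left fun h' => ?_⟩
      have : ‖(1 : ℂ)‖ ≤ ‖x i t‖ + ‖x i t - 1‖ := by
        calc _ = ‖x i t - (x i t - 1)‖ := by simp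
          _ ≤ _ := norm_sub_le _ _
      rw [norm_one] at this
      linarith
    rw [this]
    exact isOpen_lt (by fun_prop) continuous_const
  refine ⟨_, hloc, ?_, ?_, ?_⟩
  · intro w
    by_contra! h
    have hle : ‖x (Finite.equivFin W w)‖ ≤ 2 * δ := by
      refine (ContinuousMap.norm_le _ (by linarith)).mpr fun t => ?_
      refine (h01 _ t).resolve_right fun h' => h t ?_
      rw [← (hι t _).mp h', Equiv.symm_apply_apply]
    linarith [hnorm (Finite.equivFin W w)]
  · intro t
    by_contra h
    have h1 := hrel _ _ t h
    have h2 := hexcl _ (hι1 t)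
    have h3 := hexcl _ (hι1 (r t))
    nlinarith
  · intro i
    refine (ContinuousMap.norm_le _ (by linarith)).mpr fun t => ?_
    rw [ContinuousMap.sub_apply, indTuple_apply]
    by_cases h : i = ι t
    · rw [if_pos (by rw [h]), h]
      exact hι1 t
    · rw [if_neg (by rw [EmbeddingLike.apply_eq_iff_eq]; exact Ne.symm h), sub_zero]
      exact (h01 i t).resolve_right fun h' => h ((hι t i).mp h')

end

/-! ### Transfer between `C(X)` and the models of its theory -/

/-- Room for the bounds on the defect in `exists_norm_sub_indTuple_le`. -/
theorem exists_small (N : ℕ) {ε : ℝ} (hε : 0 < ε) :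
    ∃ δ : ℝ, 0 < δ ∧ δ ≤ 1 / 8 ∧ δ * (2 * N + 1) < 1 ∧ 2 * δ ≤ ε := by
  have hN : (0 : ℝ) < 2 * N + 1 := by positivity
  refine ⟨min (1 / 8) (min (1 / (2 * (2 * N + 1))) (ε / 2)), by positivity, min_le_left _ _, ?_, ?_⟩
  · calc _ ≤ 1 / (2 * (2 * N + 1)) * (2 * N + 1 : ℝ) := by
          gcongr; exact (min_le_right _ _).trans (min_le_left _ _)
      _ < 1 := by field_simp; norm_num
  · have := (min_le_right (1 / 8 : ℝ) (min (1 / (2 * (2 * N + 1))) (ε / 2))).trans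
      (min_le_right _ _)
    calc _ ≤ 2 * (ε / 2) := by gcongr
      _ = ε := by ring

section Transfer

variable {X : Type u} [UniformSpace X] [CompactSpace X] [T0Space X] [(𝓤 X).IsCountablyGenerated]
  {σ : X ≃ₜ X}

theorem HasLiftingProperty.value_indTuple_eq (hσ : HasLiftingProperty σ) {n : ℕ} (hn : 1 ≤ n)
    {φ φ' : X → SpiralUnion n} (hφ : IsSpiralMap σ φ) (hφ' : IsSpiralMap σ φ')
    (Φ : CFormula (Nat.card (SpiralUnion n))) :
    Φ.value (koopman σ) (indTuple hφ'.locallyConstant) =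
      Φ.value (koopman σ) (indTuple hφ.locallyConstant) := by
  obtain ⟨h, hh, e⟩ := hσ.exists_homeomorph hn hφ' hφ
  rw [← Φ.value_starAlgEquiv (koopman σ) (koopman σ) (koopman h)]
  · congr 1
    funext i
    ext x
    rw [koopman_apply, indTuple_apply, indTuple_apply, e]
  · intro f
    ext x
    simp only [koopman_apply, hh]

variable {K : Type v} [TopologicalSpace K] [CompactSpace K] {r : K ≃ₜ K}

/-- In a model of the theory of `C(X)`, the indicator tuples of maps onto a spiral union have the
same type as those in `C(X)`: the latter all have the same type, by homogeneity, and by stability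
this is expressed by sentences. -/
theorem IsModelOf.value_indTuple_eq (hσ : HasLiftingProperty σ)
    (hr : IsModelOf (koopman r) (theoryOf (koopman σ))) {n : ℕ} (hn : 1 ≤ n)
    {φ : X → SpiralUnion n} (hφ : IsSpiralMap σ φ) {θ : K → SpiralUnion n} (hθ : IsSpiralMap r θ)
    (Φ : CFormula (Nat.card (SpiralUnion n))) :
    Φ.value (koopman r) (indTuple hθ.locallyConstant) =
      Φ.value (koopman σ) (indTuple hφ.locallyConstant) := by
  set c := Φ.value (koopman σ) (indTuple hφ.locallyConstant) with hc
  refine eq_of_abs_sub_le_all fun ε hε => ?_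
  obtain ⟨δ₀, hδ₀, hΦ⟩ := Φ.exists_abs_value_sub_le (koopman σ) 1 hε
  obtain ⟨δ, hδ, h1, h2, h3⟩ := exists_small (Nat.card (SpiralUnion n)) hδ₀
  let Ψ : CFormula (Nat.card (SpiralUnion n)) := .comp₂ (fun u v => min u v) (by fun_prop)
    (.comp (fun u => δ - u) (by fun_prop) (defectFormula (SpiralUnion.Rel n)))
    (.comp (fun u => |u - c| - ε) (by fun_prop) Φ)
  have hA : Ψ.supAll.value (koopman σ) Fin.elim0 ≤ 0 := by
    rw [CFormula.value_supAll_le_iff]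
    intro b hb
    simp only [Ψ, CFormula.value_comp₂, CFormula.value_comp]
    rcases le_or_gt δ ((defectFormula (SpiralUnion.Rel n)).value (koopman σ) b) with h | h
    · exact (min_le_left _ _).trans (by linarith)
    · refine (min_le_right _ _).trans ?_
      obtain ⟨φ', hφ', hs, hR, hb'⟩ := exists_norm_sub_indTuple_le σ h1 h2 h.le
      have := hΦ b (indTuple hφ') hb (norm_indTuple_le hφ') fun i => (hb' i).trans h3
      rw [hσ.value_indTuple_eq hn hφ ⟨hφ', hs, hR⟩ Φ] at this
      linarith
  rw [← hr.value_eq, CFormula.value_supAll_le_iff] at hA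
  have := hA _ (norm_indTuple_le hθ.locallyConstant)
  simp only [Ψ, CFormula.value_comp₂, CFormula.value_comp, value_defectFormula_indTuple r
    hθ.locallyConstant hθ.surjective hθ.rel] at this
  rcases min_le_iff.mp this with h | h <;> linarith

omit [T0Space X] [(𝓤 X).IsCountablyGenerated] in
/-- A model of the theory of `C(X)` has maps onto spiral unions, like `X`. -/
theorem IsModelOf.exists_isSpiralMap (hr : IsModelOf (koopman r) (theoryOf (koopman σ))) {n : ℕ}
    {φ : X → SpiralUnion n} (hφ : IsSpiralMap σ φ) :
    ∃ θ : K → SpiralUnion n, IsSpiralMap r θ := by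
  obtain ⟨δ, hδ, h1, h2, -⟩ := exists_small (Nat.card (SpiralUnion n)) one_pos
  have hlt : (defectFormula (SpiralUnion.Rel n)).infAll.value (koopman σ) Fin.elim0 < δ := by
    rw [CFormula.value_infAll_lt_iff]
    refine ⟨_, norm_indTuple_le hφ.locallyConstant, ?_⟩
    rwa [value_defectFormula_indTuple σ hφ.locallyConstant hφ.surjective hφ.rel]
  rw [← hr.value_eq, CFormula.value_infAll_lt_iff] at hlt
  obtain ⟨b, -, hb⟩ := hlt
  obtain ⟨θ, hθ, hs, hR, -⟩ := exists_norm_sub_indTuple_le r h1 h2 hb.le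
  exact ⟨θ, hθ, hs, hR⟩

open Classical in
/-- The formula saying how far a tuple indexed by `W_n` is from being the image under `ξ` of a
tuple of small defect indexed by `W_{n+1}`; the latter comes first among the variables. -/
noncomputable def liftFormula (n : ℕ) :
    CFormula (Nat.card (SpiralUnion n) + Nat.card (SpiralUnion (n + 1))) :=
  .comp₂ (fun u v => u + v) (by fun_prop)
    ((defectFormula (SpiralUnion.Rel (n + 1))).subst fun i => .var (blockFst i))
    (.sum fun i => .norm (.sub (.var (blockSnd i))
      (.sum (Finset.univ.filter fun j => SpiralUnion.xi n ((Finite.equivFin _).symm j) =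
        (Finite.equivFin _).symm i) fun j => .var (blockFst j))))

open Classical in
theorem value_liftFormula {A : Type u} [CStarAlgebra A] (τ : A ≃⋆ₐ[ℂ] A) (n : ℕ)
    (b : Fin (Nat.card (SpiralUnion (n + 1))) → A) (a : Fin (Nat.card (SpiralUnion n)) → A) :
    (liftFormula n).value τ (blockTuple b a) =
      (defectFormula (SpiralUnion.Rel (n + 1))).value τ b +
      ∑ i, ‖a i - ∑ j with SpiralUnion.xi n ((Finite.equivFin _).symm j) =
        (Finite.equivFin _).symm i, b j‖ := by
  rw [liftFormula, CFormula.value_comp₂, CFormula.value_subst_blockFst, CFormula.value_sum]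
  simp only [CFormula.value, CTerm.eval_sub, CTerm.eval_sum, CTerm.eval, blockTuple_fst,
    blockTuple_snd]

/-- Lifting of maps onto spiral unions is inherited by the models of the theory of `C(X)`. -/
theorem IsModelOf.liftsFinely (hσ : HasLiftingProperty σ)
    (hr : IsModelOf (koopman r) (theoryOf (koopman σ))) : LiftsFinely r {univ} := by
  classical
  rintro n hn θ hθ V rfl
  refine ⟨1, le_rfl, ?_⟩
  suffices h : ∃ θ' : K → SpiralUnion (n + 1), IsSpiralMap r θ' ∧ θ = SpiralUnion.xi n ∘ θ' by
    obtain ⟨θ', hθ', e⟩ := h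
    exact ⟨θ', hθ', fun _ _ _ => mem_univ _, e⟩
  obtain ⟨φ₁, hφ₁⟩ := hσ.1
  obtain ⟨φ, hφ⟩ : ∃ φ : X → SpiralUnion n, IsSpiralMap σ φ := by
    induction n, hn using Nat.le_induction with
    | base => exact ⟨φ₁, hφ₁⟩
    | succ n hn ih =>
      obtain ⟨φ, hφ⟩ := ih _ (hθ.xi hn)
      obtain ⟨φ', hφ', -⟩ := hσ.liftsFinely.exists_lift_succ ⟨univ, univ_mem⟩ hn hφ
      exact ⟨φ', hφ'⟩
  obtain ⟨φ', hφ', e⟩ := hσ.liftsFinely.exists_lift_succ ⟨univ, univ_mem⟩ hn hφ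
  obtain ⟨δ, hδ, hδ8, hδN, -⟩ := exists_small (Nat.card (SpiralUnion (n + 1))) one_pos
  have hval : (CFormula.infBlock 1 _ (liftFormula n)).value (koopman σ)
      (indTuple hφ.locallyConstant) < δ := by
    rw [CFormula.value_infBlock_lt_iff]
    refine ⟨indTuple hφ'.locallyConstant, fun i => ?_, ?_⟩
    · simpa using norm_indTuple_le hφ'.locallyConstant i
    · rw [value_liftFormula, value_defectFormula_indTuple σ hφ'.locallyConstant hφ'.surjective
        hφ'.rel, zero_add, Finset.sum_eq_zero]
      · exact hδ
      · intro i _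
        rw [norm_eq_zero]
        ext x
        simp only [ContinuousMap.sub_apply, ContinuousMap.sum_apply, ContinuousMap.zero_apply,
          indTuple_apply, Equiv.eq_symm_apply, Finset.sum_ite_eq, Finset.mem_filter,
          Finset.mem_univ, true_and, Equiv.symm_apply_apply, e, Function.comp_apply, sub_self]
  rw [← IsModelOf.value_indTuple_eq hσ hr hn hφ hθ, CFormula.value_infBlock_lt_iff] at hval
  obtain ⟨b, -, hb⟩ := hval
  rw [value_liftFormula] at hb
  have hsum_nonneg : 0 ≤ ∑ i, ‖indTuple hθ.locallyConstant i -
      ∑ j with SpiralUnion.xi n ((Finite.equivFin _).symm j) = (Finite.equivFin _).symm i, b j‖ :=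
    Finset.sum_nonneg fun i _ => norm_nonneg _
  obtain ⟨θ', hθ', hs, hR, hclose⟩ := exists_norm_sub_indTuple_le r
    hδ8 hδN (by linarith : _ ≤ δ)
  refine ⟨θ', ⟨hθ', hs, hR⟩, funext fun t => ?_⟩
  by_contra hne
  set i := Finite.equivFin _ (SpiralUnion.xi n (θ' t)) with hi
  have hb0 := value_defectFormula_nonneg r (SpiralUnion.Rel (n + 1)) b
  have h1 : ‖indTuple hθ.locallyConstant i -
      ∑ j with SpiralUnion.xi n ((Finite.equivFin _).symm j) = (Finite.equivFin _).symm i, b j‖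
      ≤ δ := by
    refine (Finset.single_le_sum (f := fun i => ‖indTuple hθ.locallyConstant i -
      ∑ j with SpiralUnion.xi n ((Finite.equivFin _).symm j) = (Finite.equivFin _).symm i, b j‖)
      (fun _ _ => norm_nonneg _) (Finset.mem_univ i)).trans ?_
    linarith
  have h2 := (ContinuousMap.norm_coe_le_norm _ t).trans h1
  have h3 : indTuple hθ.locallyConstant i t = 0 := by
    rw [indTuple_apply, if_neg]
    rw [hi, Equiv.symm_apply_apply]
    exact hne
  rw [ContinuousMap.sub_apply, h3, zero_sub, norm_neg, ContinuousMap.sum_apply] at h2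
  have h4 : ‖∑ j with SpiralUnion.xi n ((Finite.equivFin _).symm j) = (Finite.equivFin _).symm i,
      (b j t - indTuple hθ' j t)‖ ≤ Nat.card (SpiralUnion (n + 1)) * (2 * δ) := by
    refine (norm_sum_le_of_le _ fun j _ =>
      (ContinuousMap.norm_coe_le_norm (b j - indTuple hθ' j) t).trans (hclose j)).trans ?_
    rw [Finset.sum_const, nsmul_eq_mul]
    have : 0 ≤ 2 * δ := by positivity
    gcongr
    exact (Finset.card_le_univ _).trans (by simp)
  have h5 : ∑ j with SpiralUnion.xi n ((Finite.equivFin _).symm j) = (Finite.equivFin _).symm i,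
      indTuple hθ' j t = 1 := by
    simp only [indTuple_apply, Equiv.eq_symm_apply, Finset.sum_ite_eq, Finset.mem_filter,
      Finset.mem_univ, true_and, Equiv.symm_apply_apply, hi, if_true]
  rw [Finset.sum_sub_distrib, h5] at h4
  have h6 : (1 : ℝ) ≤ δ + Nat.card (SpiralUnion (n + 1)) * (2 * δ) := by
    refine le_trans ?_ (add_le_add h2 h4)
    refine le_trans (le_of_eq ?_) (norm_sub_le _ _)
    rw [sub_sub_cancel, norm_one]
  linarith

/-- The function `g ∘ φ` is a linear combination of the indicator functions of the fibres of `φ`. -/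
theorem pullback_eq_eval_sum {W : Type*} [Finite W] {φ : K → W} (hφ : IsLocallyConstant φ)
    (g : W → ℂ) : pullback hφ g = (CTerm.sum Finset.univ
      fun i => .smul (g ((Finite.equivFin W).symm i)) (.var i)).eval (koopman r) (indTuple hφ) := by
  rw [CTerm.eval_sum]
  ext x
  simp only [CTerm.eval, ContinuousMap.sum_apply, ContinuousMap.smul_apply, indTuple_apply,
    Equiv.eq_symm_apply, smul_eq_mul, mul_ite, mul_one, mul_zero, Finset.sum_ite_eq,
    Finset.mem_univ, if_true, Equiv.symm_apply_apply]
  rfl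

theorem norm_pullback_sub_le {X' W : Type*} [TopologicalSpace X'] {φ : K → W}
    (hφ : IsLocallyConstant φ)
    (f : C(X', ℂ)) (π : C(K, X')) (s : W → X') {δ : ℝ} (hδ : 0 ≤ δ)
    (h : ∀ t, ‖f (π t) - f (s (φ t))‖ ≤ δ) : ‖f.comp π - pullback hφ (f ∘ s)‖ ≤ δ :=
  (ContinuousMap.norm_le _ hδ).mpr h

/-- If `σ` has the lifting property, then `C(X)` embeds elementarily into every model of its theory
which is of the form `C(K)`. -/
theorem HasLiftingProperty.exists_isElementaryEmbedding (hσ : HasLiftingProperty σ)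
    (hr : IsModelOf (koopman r) (theoryOf (koopman σ))) :
    ∃ h : C(X, ℂ) → C(K, ℂ), IsElementaryEmbedding (koopman σ) (koopman r) h := by
  obtain ⟨φ₁, hφ₁⟩ := hσ.1
  obtain ⟨θ₁, hθ₁⟩ := hr.exists_isSpiralMap hφ₁
  obtain ⟨S, π, -, hπ, -, hfine, -⟩ := exists_intertwining hσ (hr.liftsFinely hσ)
    (V' := fun _ => univ) (fun _ => rfl) le_rfl hφ₁ hθ₁
  refine ⟨fun f => f.comp π, fun m Φ a => eq_of_abs_sub_le_all fun ε hε => ?_⟩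
  obtain ⟨R, hR⟩ := exists_forall_norm_le a
  obtain ⟨δ, hδ, hA⟩ := Φ.exists_abs_value_sub_le (koopman σ) R (half_pos hε)
  obtain ⟨δ', hδ', hB⟩ := Φ.exists_abs_value_sub_le (koopman r) R (half_pos hε)
  have hη : 0 < min δ δ' := lt_min hδ hδ'
  obtain ⟨i, hi⟩ : ∃ i, ∀ x y, (S i).φ x = (S i).φ y → ∀ j, ‖a j x - a j y‖ ≤ min δ δ' := by
    have hV : {p : X × X | ∀ j, ‖a j p.1 - a j p.2‖ ≤ min δ δ'} ∈ 𝓤 X := by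
      refine (eventually_all (l := 𝓤 X)).mpr fun j => ?_
      have hu := CompactSpace.uniformContinuous_of_continuous (a j).continuous
      filter_upwards [hu (Metric.dist_mem_uniformity hη)] with p hp
      exact (dist_eq_norm (a j p.1) (a j p.2) ▸ (show dist (a j p.1) (a j p.2) < _ from hp)).le
    obtain ⟨i, hi⟩ := hfine _ hV
    exact ⟨i, fun x y h => hi x y h⟩
  obtain ⟨s, hs⟩ := (S i).isSpiralMap_φ.surjective.hasRightInverse
  have hφ := (S i).isSpiralMap_φ.locallyConstant
  have hθ := (S i).isSpiralMap_θ.locallyConstant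
  have hR0 : ∀ j, 0 ≤ R := fun j => (norm_nonneg _).trans (hR j)
  have hpt : ∀ j x, ‖a j x‖ ≤ R := fun j x => (ContinuousMap.norm_coe_le_norm _ x).trans (hR j)
  have h1 : |Φ.value (koopman σ) a - Φ.value (koopman σ) fun j => pullback hφ (a j ∘ s)| ≤
      ε / 2 := by
    refine hA _ _ hR (fun j => (ContinuousMap.norm_le _ (hR0 j)).mpr fun x => hpt j _) fun j => ?_
    refine norm_pullback_sub_le hφ (a j) (ContinuousMap.id X) s hδ.le fun x => ?_
    exact (hi _ _ (hs _).symm j).trans (min_le_left _ _)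
  have h2 : |Φ.value (koopman r) (fun j => (a j).comp π) -
      Φ.value (koopman r) fun j => pullback hθ (a j ∘ s)| ≤ ε / 2 := by
    refine hB _ _ (fun j => (ContinuousMap.norm_le _ (hR0 j)).mpr fun x => hpt j _)
      (fun j => (ContinuousMap.norm_le _ (hR0 j)).mpr fun x => hpt j _) fun j => ?_
    refine norm_pullback_sub_le hθ (a j) π s hδ'.le fun t => ?_
    exact (hi _ _ (by rw [hs, hπ]) j).trans (min_le_right _ _)
  have h3 : (Φ.value (koopman r) fun j => pullback hθ (a j ∘ s)) =
      Φ.value (koopman σ) fun j => pullback hφ (a j ∘ s) := by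
    simp only [pullback_eq_eval_sum (r := r), pullback_eq_eval_sum (r := σ)]
    rw [← CFormula.value_subst, ← CFormula.value_subst]
    exact hr.value_indTuple_eq hσ (S i).one_le (S i).isSpiralMap_φ (S i).isSpiralMap_θ _
  rw [h3] at h2
  rw [abs_sub_comm] at h1
  calc _ ≤ _ := abs_sub_le _ _ _
    _ ≤ ε / 2 + ε / 2 := add_le_add h2 h1
    _ = ε := add_halves ε

end Transfer

/-! ### Models of the theory are commutative -/

theorem IsModelOf.mul_comm {A : Type u} [CommCStarAlgebra A] {τ : A ≃⋆ₐ[ℂ] A} {B : Type v}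
    [CStarAlgebra B] {ρ : B ≃⋆ₐ[ℂ] B} (h : IsModelOf ρ (theoryOf τ)) (x y : B) :
    x * y = y * x := by
  let Φ : CFormula 2 := .norm (.sub (.mul (.var 0) (.var 1)) (.mul (.var 1) (.var 0)))
  have hA : Φ.supAll.value τ Fin.elim0 ≤ 0 := by
    rw [CFormula.value_supAll_le_iff]
    intro b _
    simp [Φ, CFormula.value, CTerm.eval_sub, CTerm.eval, _root_.mul_comm (b 0)]
  rw [← h.value_eq, CFormula.value_supAll_le_iff] at hA
  have hball : ∀ x y : B, ‖x‖ ≤ 1 → ‖y‖ ≤ 1 → x * y = y * x := by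
    intro x y hx hy
    have := hA ![x, y] (by simp [Fin.forall_fin_two, hx, hy])
    simp only [Φ, CFormula.value, CTerm.eval_sub, CTerm.eval] at this
    exact sub_eq_zero.mp (norm_le_zero_iff.mp this)
  have hscale : ∀ x : B, ∃ c : ℂ, c ≠ 0 ∧ ‖c • x‖ ≤ 1 := by
    intro x
    refine ⟨((‖x‖ + 1)⁻¹ : ℝ), by exact_mod_cast (by positivity : (‖x‖ + 1)⁻¹ ≠ 0), ?_⟩
    rw [norm_smul, Complex.norm_real, Real.norm_of_nonneg (by positivity),
      inv_mul_le_iff₀ (by positivity)]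
    linarith
  obtain ⟨c, hc, hcx⟩ := hscale x
  obtain ⟨d, hd, hdy⟩ := hscale y
  have := hball _ _ hcx hdy
  rw [smul_mul_smul_comm, smul_mul_smul_comm, _root_.mul_comm d c] at this
  exact smul_right_injective B (mul_ne_zero hc hd) this

/-- Gelfand duality for a commutative C*-algebra with an automorphism. -/
theorem exists_starAlgEquiv_koopman {B : Type v} [CommCStarAlgebra B] (ρ : B ≃⋆ₐ[ℂ] B) :
    ∃ r : WeakDual.characterSpace ℂ B ≃ₜ WeakDual.characterSpace ℂ B,
      ∀ b, gelfandStarTransform B (ρ b) = koopman r (gelfandStarTransform B b) := by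
  refine ⟨⟨⟨WeakDual.CharacterSpace.compContinuousMap (ρ : B →⋆ₐ[ℂ] B),
    WeakDual.CharacterSpace.compContinuousMap (ρ.symm : B →⋆ₐ[ℂ] B), ?_, ?_⟩,
    ContinuousMap.continuous _, ContinuousMap.continuous _⟩, fun b => ?_⟩
  · intro χ
    ext b
    simp
  · intro χ
    ext b
    simp
  · ext χ
    rfl

theorem HasLiftingProperty.isPrimeModelOfItsTheory {X : Type u} [UniformSpace X] [CompactSpace X]
    [T0Space X] [(𝓤 X).IsCountablyGenerated] {σ : X ≃ₜ X} (hσ : HasLiftingProperty σ) :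
    IsPrimeModelOfItsTheory.{u, v} (koopman σ) := by
  intro B _ ρ hρ
  let _ : CommCStarAlgebra B := { ‹CStarAlgebra B› with mul_comm := hρ.mul_comm }
  obtain ⟨r, hr⟩ := exists_starAlgEquiv_koopman ρ
  have hmodel : IsModelOf (koopman r) (theoryOf (koopman σ)) := by
    intro φ hφ
    rw [← hρ φ hφ, ← φ.value_starAlgEquiv ρ (koopman r) (gelfandStarTransform B) hr]
    congr 1
    exact Subsingleton.elim _ _
  obtain ⟨h, hh⟩ := hσ.exists_isElementaryEmbedding hmodel
  refine ⟨fun f => (gelfandStarTransform B).symm (h f), fun n φ a => ?_⟩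
  rw [← hh n φ a, ← φ.value_starAlgEquiv ρ (koopman r) (gelfandStarTransform B) hr]
  congr 1
  exact funext fun i => (gelfandStarTransform B).apply_symm_apply (h (a i))

/-! ### Clopen partitions of the Cantor set -/

theorem exists_forall_lt_eq_imp_mem {V : Set ((ℕ → Bool) × (ℕ → Bool))} (hV : V ∈ 𝓤 (ℕ → Bool)) :
    ∃ m : ℕ, ∀ x y : ℕ → Bool, (∀ i < m, x i = y i) → (x, y) ∈ V := by
  have h𝓤 : 𝓤 (ℕ → Bool) = ⨅ i : ℕ, 𝓟 {p | p.1 i = p.2 i} := by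
    rw [Pi.uniformity]
    refine iInf_congr fun i => ?_
    rw [show 𝓤 Bool = 𝓟 SetRel.id from rfl, comap_principal]
    rfl
  rw [h𝓤, (hasBasis_iInf_principal_finite _).mem_iff] at hV
  obtain ⟨t, ht, hV⟩ := hV
  obtain ⟨m, hm⟩ := ht.bddAbove
  refine ⟨m + 1, fun x y h => hV ?_⟩
  simp only [mem_iInter]
  exact fun i hi => h i (Nat.lt_succ_of_le (hm hi))

theorem IsLocallyConstant.exists_forall_lt_eq {E : Type*} {α : (ℕ → Bool) → E}
    (hα : IsLocallyConstant α) :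
    ∃ m : ℕ, ∀ x y : ℕ → Bool, (∀ i < m, x i = y i) → α x = α y := by
  let _ : UniformSpace E := ⊥
  have hu := CompactSpace.uniformContinuous_of_continuous hα.continuous
  exact exists_forall_lt_eq_imp_mem (hu (mem_principal_self SetRel.id))

/-- Splitting off the first `m` entries of a sequence. -/
def cantorSplit (m : ℕ) : (ℕ → Bool) ≃ₜ (Fin m → Bool) × (ℕ → Bool) where
  toFun x := (fun i => x i, fun n => x (n + m))
  invFun p n := if h : n < m then p.1 ⟨n, h⟩ else p.2 (n - m)
  left_inv x := by
    funext n
    by_cases h : n < m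
    · simp [h]
    · simp [h, Nat.sub_add_cancel (not_lt.mp h)]
  right_inv p := by
    ext <;> simp
  continuous_toFun := by fun_prop
  continuous_invFun := by
    refine continuous_pi fun n => ?_
    by_cases h : n < m
    · simp only [h, dif_pos]; fun_prop
    · simp only [h, dif_neg, not_false_eq_true]; fun_prop

theorem nonempty_fin_prod_cantor (n : ℕ) : Nonempty (Fin (n + 1) × (ℕ → Bool) ≃ₜ (ℕ → Bool)) := by
  have h1 : Nonempty (Fin 1 × (ℕ → Bool) ≃ₜ (ℕ → Bool)) :=
    ⟨Homeomorph.uniqueProd (Fin 1) (ℕ → Bool)⟩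
  have h2 : Nonempty ((ℕ → Bool) ⊕ (ℕ → Bool) ≃ₜ (ℕ → Bool)) := by
    obtain ⟨h1⟩ := h1
    have e : Fin 1 ⊕ Fin 1 ≃ (Fin 1 → Bool) :=
      finSumFinEquiv.trans (finTwoEquiv.trans (Equiv.funUnique (Fin 1) Bool).symm)
    exact ⟨(h1.symm.sumCongr h1.symm).trans (Homeomorph.sumProdDistrib.symm.trans
      ((e.toHomeomorphOfDiscrete.prodCongr (.refl _)).trans (cantorSplit 1).symm))⟩
  induction n with
  | zero => exact h1
  | succ n ih =>
    obtain ⟨h1⟩ := h1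
    obtain ⟨h2⟩ := h2
    obtain ⟨ih⟩ := ih
    exact ⟨((finSumFinEquiv (m := n + 1) (n := 1)).symm.toHomeomorphOfDiscrete.prodCongr
      (.refl _)).trans (Homeomorph.sumProdDistrib.trans ((ih.sumCongr h1).trans h2))⟩

theorem nonempty_prod_cantor (F : Type*) [Finite F] [Nonempty F] [TopologicalSpace F]
    [DiscreteTopology F] : Nonempty (F × (ℕ → Bool) ≃ₜ (ℕ → Bool)) := by
  obtain ⟨n, hn⟩ : ∃ n, Nat.card F = n + 1 := ⟨Nat.card F - 1, by
    have := Nat.card_pos (α := F); omega⟩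
  obtain ⟨h⟩ := nonempty_fin_prod_cantor n
  exact ⟨((Finite.equivFinOfCardEq hn).toHomeomorphOfDiscrete.prodCongr (.refl _)).trans h⟩

/-- A partition of the Cantor set into finitely many nonempty clopen sets is, up to a homeomorphism,
a partition into copies of the Cantor set. -/
theorem exists_homeomorph_prod_cantor {E : Type*} [Finite E] [TopologicalSpace E]
    [DiscreteTopology E] {α : (ℕ → Bool) → E} (hα : IsLocallyConstant α)
    (hs : Function.Surjective α) :
    ∃ Θ : (ℕ → Bool) ≃ₜ E × (ℕ → Bool), ∀ x, (Θ x).1 = α x := by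
  obtain ⟨m, hm⟩ := hα.exists_forall_lt_eq
  let a : (Fin m → Bool) → E := fun u => α ((cantorSplit m).symm (u, fun _ => false))
  have ha : ∀ x, α x = a (cantorSplit m x).1 := by
    intro x
    refine hm _ _ fun i hi => ?_
    simp [cantorSplit, hi]
  have hsa : Function.Surjective a := fun e => by
    obtain ⟨x, rfl⟩ := hs e
    exact ⟨_, (ha x).symm⟩
  have H : ∀ e, Nonempty ({u // a u = e} × (ℕ → Bool) ≃ₜ (ℕ → Bool)) := by
    intro e
    have : Nonempty {u // a u = e} := by
      obtain ⟨u, hu⟩ := hsa e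
      exact ⟨⟨u, hu⟩⟩
    exact nonempty_prod_cantor _
  let H' := fun e => (H e).some
  have hH : ∀ e (z : {u // a u = e} × (ℕ → Bool)),
      (a z.1.1, H' (a z.1.1) (⟨z.1.1, rfl⟩, z.2)) = (e, H' e z) := by
    rintro _ ⟨⟨u, rfl⟩, x⟩
    rfl
  let G : (Fin m → Bool) × (ℕ → Bool) ≃ E × (ℕ → Bool) :=
    { toFun := fun p => (a p.1, H' (a p.1) (⟨p.1, rfl⟩, p.2))
      invFun := fun q => (((H' q.1).symm q.2).1, ((H' q.1).symm q.2).2)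
      left_inv := fun p => by simp only [Homeomorph.symm_apply_apply]
      right_inv := fun q => by
        have := hH q.1 ((H' q.1).symm q.2)
        rwa [Homeomorph.apply_symm_apply] at this }
  have hG : Continuous G := by
    refine continuous_prod_of_discrete_left.mpr fun u => ?_
    exact Continuous.prodMk (f := fun _ => a u) continuous_const
      ((H' (a u)).continuous.comp (Continuous.prodMk (f := fun _ : ℕ → Bool =>
        (⟨u, rfl⟩ : {v // a v = a u})) continuous_const continuous_id))
  exact ⟨(cantorSplit m).trans hG.homeoOfEquivCompactToT2, fun x => (ha x).symm⟩

/-- Any two partitions of the Cantor set into nonempty clopen sets with the same finite index set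
are exchanged by a homeomorphism. -/
theorem exists_homeomorph_comp_eq {E : Type*} [Finite E] {α β : (ℕ → Bool) → E}
    (hα : IsLocallyConstant α) (hαs : Function.Surjective α)
    (hβ : IsLocallyConstant β) (hβs : Function.Surjective β) :
    ∃ τ : (ℕ → Bool) ≃ₜ (ℕ → Bool), ∀ x, β (τ x) = α x := by
  let _ : TopologicalSpace E := ⊥
  have : DiscreteTopology E := ⟨rfl⟩
  obtain ⟨Θ, hΘ⟩ := exists_homeomorph_prod_cantor hα hαs
  obtain ⟨Θ', hΘ'⟩ := exists_homeomorph_prod_cantor hβ hβs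
  exact ⟨Θ.trans Θ'.symm, fun x => by simp [← hΘ, ← hΘ']⟩

/-- A clopen partition of the Cantor set can be refined to one with any prescribed finite nonempty
number of nonempty pieces in each of its sets. -/
theorem exists_isLocallyConstant_lift {E Q : Type*} [Finite E] {D : (ℕ → Bool) → Q}
    (hD : IsLocallyConstant D) (π : E → Q) (h₁ : ∀ e, ∃ x, D x = π e) (h₂ : ∀ x, ∃ e, π e = D x) :
    ∃ α : (ℕ → Bool) → E, IsLocallyConstant α ∧ Function.Surjective α ∧ ∀ x, π (α x) = D x := by
  let _ : TopologicalSpace E := ⊥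
  have : DiscreteTopology E := ⟨rfl⟩
  let _ : TopologicalSpace (range D) := ⊥
  have : DiscreteTopology (range D) := ⟨rfl⟩
  have : Finite (range D) := hD.range_finite
  have hD' : IsLocallyConstant (rangeFactorization D) := by
    refine IsLocallyConstant.iff_isOpen_fiber.mpr fun q => ?_
    convert hD.isOpen_fiber q.1 using 1
    ext x
    simp [rangeFactorization, Subtype.ext_iff]
  obtain ⟨Θ, hΘ⟩ := exists_homeomorph_prod_cantor hD' rangeFactorization_surjective
  have hs : ∀ q : range D, ∃ s : (ℕ → Bool) → {e // π e = q}, Continuous s ∧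
      Function.Surjective s := by
    rintro ⟨_, x, rfl⟩
    have : Nonempty {e // π e = D x} := by
      obtain ⟨e, he⟩ := h₂ x
      exact ⟨⟨e, he⟩⟩
    obtain ⟨H⟩ := nonempty_prod_cantor {e // π e = D x}
    exact ⟨Prod.fst ∘ H.symm, by fun_prop, Prod.fst_surjective.comp H.symm.surjective⟩
  choose s hsc hss using hs
  refine ⟨fun x => s (Θ x).1 (Θ x).2, ?_, ?_, ?_⟩
  · rw [IsLocallyConstant.iff_continuous]
    have : Continuous fun p : range D × (ℕ → Bool) => (s p.1 p.2 : E) :=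
      continuous_prod_of_discrete_left.mpr fun q => continuous_subtype_val.comp (hsc q)
    exact this.comp Θ.continuous
  · intro e
    obtain ⟨x, hx⟩ := h₁ e
    obtain ⟨y, hy⟩ := hss ⟨D x, x, rfl⟩ ⟨e, hx.symm⟩
    have : ∀ p, p = (⟨D x, x, rfl⟩, y) → (s p.1 p.2 : E) = e := by
      rintro _ rfl
      rw [hy]
    exact ⟨Θ.symm (⟨D x, x, rfl⟩, y), this _ (Θ.apply_symm_apply _)⟩
  · intro x
    rw [(s (Θ x).1 (Θ x).2).2, hΘ]
    rfl

/-- Let `f` map a finite graph `(W, R)`, all of whose vertices have a successor and a predecessor,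
onto the graph of transitions between the sets of a clopen partition `c`, also surjectively on
edges. Then there are a homeomorphism `τ` with `c ∘ τ = c ∘ σ` and a map of `(X, τ)` onto `(W, R)`
through which `c` factors by `f`. -/
theorem exists_homeomorph_of_graph (σ : (ℕ → Bool) ≃ₜ (ℕ → Bool)) {W P : Type*} [Finite W]
    {R : W → W → Prop} (hout : ∀ w, ∃ v, R w v) (hin : ∀ v, ∃ w, R w v)
    {c : (ℕ → Bool) → P} (hc : IsLocallyConstant c) (f : W → P)
    (hf : ∀ w v, R w v → ∃ x, c x = f w ∧ c (σ x) = f v)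
    (hf' : ∀ x, ∃ w v, R w v ∧ f w = c x ∧ f v = c (σ x)) :
    ∃ (τ : (ℕ → Bool) ≃ₜ (ℕ → Bool)) (ψ : (ℕ → Bool) → W), (∀ x, c (τ x) = c (σ x)) ∧
      IsLocallyConstant ψ ∧ Function.Surjective ψ ∧ (∀ x, R (ψ x) (ψ (τ x))) ∧
      ∀ x, f (ψ x) = c x := by
  -- The sources of the edges partition `X`, and so do their targets; `τ` moves one to the other.
  have hD : IsLocallyConstant fun x => (c x, c (σ x)) :=
    hc.prodMk (hc.comp_continuous σ.continuous)
  obtain ⟨α, hα, hαs, hαD⟩ := exists_isLocallyConstant_lift hD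
    (fun e : {p : W × W // R p.1 p.2} => (f e.1.1, f e.1.2))
    (fun e => (hf _ _ e.2).imp fun x hx => Prod.ext hx.1 hx.2)
    (fun x => by
      obtain ⟨w, v, h, h1, h2⟩ := hf' x
      exact ⟨⟨(w, v), h⟩, Prod.ext h1 h2⟩)
  have hψ : IsLocallyConstant fun x => (α x).1.1 := hα.comp fun e => e.1.1
  have hψs : Function.Surjective fun x => (α x).1.1 := fun w => by
    obtain ⟨v, hv⟩ := hout w
    obtain ⟨x, hx⟩ := hαs ⟨(w, v), hv⟩
    exact ⟨x, by simp [hx]⟩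
  obtain ⟨β, hβ, hβs, hβψ⟩ := exists_isLocallyConstant_lift hψ
    (fun e : {p : W × W // R p.1 p.2} => e.1.2) (fun e => hψs _)
    (fun x => by
      obtain ⟨w, hw⟩ := hin (α x).1.1
      exact ⟨⟨(w, _), hw⟩, rfl⟩)
  obtain ⟨τ, hτ⟩ := exists_homeomorph_comp_eq hα hαs hβ hβs
  have key : ∀ x, (α (τ x)).1.1 = (α x).1.2 := fun x => by rw [← hβψ, hτ]
  simp only [Prod.mk.injEq] at hαD
  refine ⟨τ, _, fun x => ?_, hψ, hψs, fun x => ?_, fun x => (hαD x).1⟩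
  · rw [← (hαD x).2, ← (hαD (τ x)).1, key]
  · rw [key]
    exact (α x).2

/-! ### Walks in spirals -/

/-- The three kinds of bi-infinite walks in the `n`-spiral: around the left cycle, from the left
cycle through the middle segment (with the middle at time `0`), and around the right cycle. -/
def spiralWalk (n : ℕ) : XiKind → ℤ → Spiral n
  | .L, k => .left k
  | .M, k => if h : |k| < n then .mid k h else if k < 0 then .left k else .right k
  | .G, k => .right k

theorem spiralWalk_mid {n : ℕ} {k : ℤ} (h : |k| < n) : spiralWalk n .M k = .mid k h := by
  simp [spiralWalk, h]

theorem spiralWalk_neg {n : ℕ} (hn : 1 ≤ n) {k : ℤ} (h : k ≤ -n) :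
    spiralWalk n .M k = .left k := by
  have h1 : ¬ |k| < n := fun h' => by have := abs_lt.mp h'; omega
  have h2 : k < 0 := by omega
  simp [spiralWalk, h1, h2]

theorem spiralWalk_pos {n : ℕ} {k : ℤ} (h : n ≤ k) : spiralWalk n .M k = .right k := by
  have h1 : ¬ |k| < n := fun h' => by have := abs_lt.mp h'; omega
  have h2 : ¬ k < 0 := by omega
  simp [spiralWalk, h1, h2]

section

variable {n : ℕ}

theorem Spiral.Rel.eq_of_left {j : ZMod n.factorial} {t : Spiral n} (h : Spiral.Rel n (.left j) t)
    (ht : ∀ k hk, t ≠ .mid k hk) : t = .left (j + 1) := by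
  cases h with
  | left => rfl
  | enter h => exact absurd rfl (ht _ _)

theorem Spiral.Rel.eq_of_right {j : ZMod n.factorial} {t : Spiral n}
    (h : Spiral.Rel n (.right j) t) : t = .right (j + 1) := by
  cases h with
  | right => rfl

theorem Spiral.Rel.eq_left_of {j : ZMod n.factorial} {t : Spiral n}
    (h : Spiral.Rel n t (.left j)) : t = .left (j - 1) := by
  cases h with
  | left => simp

theorem Spiral.Rel.eq_right_of {j : ZMod n.factorial} {t : Spiral n}
    (h : Spiral.Rel n t (.right j)) (ht : ∀ k hk, t ≠ .mid k hk) : t = .right (j - 1) := by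
  cases h with
  | right => simp
  | exit h => exact absurd rfl (ht _ _)

theorem Spiral.Rel.eq_of_spiralWalk_mid {k : ℤ} (hk : -(n : ℤ) < k) {t : Spiral n}
    (h : Spiral.Rel n (spiralWalk n .M k) t) : t = spiralWalk n .M (k + 1) := by
  rcases lt_or_ge k n with h1 | h1
  · have h2 : |k| < n := abs_lt.mpr ⟨hk, h1⟩
    rw [spiralWalk_mid h2] at h
    cases h with
    | mid _ _ hk' => rw [spiralWalk_mid hk']
    | exit _ => rw [spiralWalk_pos (by omega)]; simp
  · rw [spiralWalk_pos h1] at h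
    rw [h.eq_of_right, spiralWalk_pos (by omega)]
    simp

theorem Spiral.Rel.eq_spiralWalk_mid_of (hn : 1 ≤ n) {k : ℤ} (hk : k < n) {t : Spiral n}
    (h : Spiral.Rel n t (spiralWalk n .M k)) : t = spiralWalk n .M (k - 1) := by
  rcases lt_or_ge (-(n : ℤ)) k with h1 | h1
  · have h2 : |k| < n := abs_lt.mpr ⟨h1, hk⟩
    rw [spiralWalk_mid h2] at h
    generalize hx : (Spiral.mid k h2 : Spiral n) = x at h
    cases h with
    | mid j hj hj' => cases hx; simp [spiralWalk_mid hj]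
    | enter h => cases hx; rw [spiralWalk_neg hn (by omega)]; simp
    | _ => cases hx
  · rw [spiralWalk_neg hn h1] at h
    rw [h.eq_left_of, spiralWalk_neg hn (by omega)]
    simp

/-- Every bi-infinite walk in a spiral is one of the three standard walks, up to a shift. -/
theorem exists_eq_spiralWalk (hn : 1 ≤ n) (s : ℤ → Spiral n)
    (hs : ∀ k, Spiral.Rel n (s k) (s (k + 1))) :
    ∃ a z, ∀ k, s k = spiralWalk n a (k + z) := by
  have two_sided : ∀ (T : ℤ → Spiral n) (k₀ : ℤ), s k₀ = T k₀ →
      (∀ k, k₀ ≤ k → s k = T k → s (k + 1) = T (k + 1)) →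
      (∀ k, k ≤ k₀ → s k = T k → s (k - 1) = T (k - 1)) → ∀ k, s k = T k := by
    intro T k₀ h0 h1 h2 k
    exact Int.inductionOn' k k₀ h0 h1 h2
  by_cases hmid : ∃ k j hj, s k = .mid j hj
  · obtain ⟨k₀, j, hj, h⟩ := hmid
    have hj' := abs_lt.mp hj
    refine ⟨.M, j - k₀, two_sided _ k₀ ?_ ?_ ?_⟩
    · rw [h, add_sub_cancel, spiralWalk_mid hj]
    · intro k hk e
      have := hs k
      rw [e] at this
      rw [this.eq_of_spiralWalk_mid (by omega)]
      congr 1; ring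
    · intro k hk e
      have := hs (k - 1)
      rw [sub_add_cancel, e] at this
      rw [this.eq_spiralWalk_mid_of hn (by omega)]
      congr 1; ring
  · push Not at hmid
    rcases h0 : s 0 with j | ⟨j, hj⟩ | j
    · obtain ⟨z, rfl⟩ := ZMod.intCast_surjective j
      refine ⟨.L, z, two_sided _ 0 (by simp [h0, spiralWalk]) ?_ ?_⟩
      · intro k _ e
        have := hs k
        rw [e] at this
        rw [this.eq_of_left (hmid _)]
        simp only [spiralWalk]; push_cast; congr 1; ring
      · intro k _ e
        have := hs (k - 1)
        rw [sub_add_cancel, e] at this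
        rw [this.eq_left_of]
        simp only [spiralWalk]; push_cast; congr 1; ring
    · exact absurd h0 (hmid _ _ _)
    · obtain ⟨z, rfl⟩ := ZMod.intCast_surjective j
      refine ⟨.G, z, two_sided _ 0 (by simp [h0, spiralWalk]) ?_ ?_⟩
      · intro k _ e
        have := hs k
        rw [e] at this
        rw [this.eq_of_right]
        simp only [spiralWalk]; push_cast; congr 1; ring
      · intro k _ e
        have := hs (k - 1)
        rw [sub_add_cancel, e] at this
        rw [this.eq_right_of (hmid _)]
        simp only [spiralWalk]; push_cast; congr 1; ring

end

/-! ### The canonical maps in terms of integer representatives -/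

/-- The integer `z` represents the point `s` of the `N`-spiral as seen from the `n`-spiral: it is
congruent modulo `n!` to the number of `s` and lies on the same side of, or at the same place in,
the middle segment of the `n`-spiral. -/
inductive Represents (n N : ℕ) : Spiral N → ℤ → Prop
  | left (i z : ℤ) (hz : z ≤ -n) (h : (z : ZMod n.factorial) = i) : Represents n N (.left i) z
  | right (i z : ℤ) (hz : n ≤ z) (h : (z : ZMod n.factorial) = i) : Represents n N (.right i) z
  | mid (j : ℤ) (hj : |j| < N) (z : ℤ) (hmid : |j| < n → z = j) (hneg : j ≤ -n → z ≤ -n)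
    (hpos : n ≤ j → n ≤ z) (h : (z : ZMod n.factorial) = j) : Represents n N (.mid j hj) z

theorem Represents.position {n k : ℕ} {s : Spiral (n + k + 1)} {z : ℤ}
    (h : Represents n (n + (k + 1)) s z) :
    ∃ i : ℤ, s.position (n + k) = i ∧ (z : ZMod n.factorial) = i := by
  cases h with
  | left i z hz h => exact ⟨i, by simp, h⟩
  | right i z hz h => exact ⟨i, by simp, h⟩
  | mid j hj z _ _ _ h => exact ⟨j, rfl, h⟩

theorem Represents.xiM {n k : ℕ} (hn : 1 ≤ n) {s : Spiral (n + k + 1)} {z : ℤ}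
    (h : Represents n (n + (k + 1)) s z) : Represents n (n + k) (s.xiM (n + k)) z := by
  cases h with
  | left i z hz h => simpa [Spiral.xiM] using Represents.left (N := n + k) i z hz h
  | right i z hz h => simpa [Spiral.xiM] using Represents.right (N := n + k) i z hz h
  | mid j hj z hmid hneg hpos h =>
    have hj' := abs_lt.mp hj
    push_cast at hj'
    rcases lt_trichotomy j (-((n + k : ℕ) : ℤ)) with h1 | h1 | h1
    · push_cast at h1; omega
    · rw [Spiral.xiM_mid_neg (by omega) hj h1]
      exact .left j z (hneg (by push_cast at h1; omega)) h
    · rcases lt_or_ge j ((n + k : ℕ) : ℤ) with h2 | h2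
      · rw [Spiral.xiM_mid_of_lt hj (abs_lt.mpr ⟨h1, h2⟩)]
        exact .mid j _ z hmid hneg hpos h
      · have h3 : j = ((n + k : ℕ) : ℤ) := by push_cast at h2 ⊢; omega
        rw [Spiral.xiM_mid_pos hj h3]
        exact .right j z (hpos (by push_cast at h3; omega)) h

/-- The kind of the composition of the maps named by the last `k` letters of a word of length
`n + k`: collapsing onto one of the cycles, according to the first of these letters that is not
`M`, or projecting straight down. -/
def tailKind (n : ℕ) : (k : ℕ) → (Fin (n + k) → XiLetter) → XiKind
  | 0, _ => .M
  | k + 1, w => match tailKind n k (Fin.init (α := fun _ => XiLetter) w) with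
    | .L => .L
    | .G => .G
    | .M => (w (Fin.last (n + k))).1

theorem xiIter_fst {n k : ℕ} (x : SpiralUnion (n + k)) :
    (SpiralUnion.xiIter n k x).1 = fun i => x.1 (Fin.castAdd k i) := by
  induction k with
  | zero => rfl
  | succ k ih => exact ih (SpiralUnion.xi (n + k) x)

theorem exists_intCast_eq_le (n : ℕ) (i : ℤ) :
    ∃ z ≤ -(n : ℤ), (z : ZMod n.factorial) = i := by
  have hf : (1 : ℤ) ≤ n.factorial := by exact_mod_cast n.factorial_pos
  refine ⟨i - n.factorial * (|i| + n), ?_, by simp⟩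
  nlinarith [le_abs_self i, abs_nonneg i]

theorem exists_intCast_eq_ge (n : ℕ) (i : ℤ) :
    ∃ z ≥ (n : ℤ), (z : ZMod n.factorial) = i := by
  have hf : (1 : ℤ) ≤ n.factorial := by exact_mod_cast n.factorial_pos
  refine ⟨i + n.factorial * (|i| + n), ?_, by simp⟩
  nlinarith [neg_abs_le i, abs_nonneg i]

/-- In terms of integer representatives, the canonical map from level `n + k` to level `n` is given
by the standard walks. -/
theorem xiIter_snd {n k : ℕ} (hn : 1 ≤ n) (w : Fin (n + k) → XiLetter) {s : Spiral (n + k)} {z : ℤ}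
    (h : Represents n (n + k) s z) :
    (SpiralUnion.xiIter n k (w, s)).2 = spiralWalk n (tailKind n k w) z := by
  induction k generalizing z with
  | zero =>
    change s = spiralWalk n .M z
    cases h with
    | left i z hz h => rw [spiralWalk_neg hn hz, h]
    | right i z hz h => rw [spiralWalk_pos hz, h]
    | mid j hj z hmid _ _ _ => obtain rfl := hmid hj; exact (spiralWalk_mid hj).symm
  | succ k ih =>
    change (SpiralUnion.xiIter n k (Fin.init (α := fun _ => XiLetter) w,
      (w (Fin.last (n + k))).1.map (n + k) s)).2 = _
    obtain ⟨i, hi, hiz⟩ := h.position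
    rw [tailKind]
    cases hlast : (w (Fin.last (n + k))).1 with
    | L =>
      obtain ⟨z', hz', e⟩ := exists_intCast_eq_le n i
      rw [XiKind.map, Spiral.xiL, hi, ih (Fin.init (α := fun _ => XiLetter) w) (.left i z' hz' e)]
      cases tailKind n k (Fin.init (α := fun _ => XiLetter) w) with
      | L => simp only [spiralWalk, e, hiz]
      | M => rw [spiralWalk_neg hn hz', e, ← hiz]; rfl
      | G => simp only [spiralWalk, e, hiz]
    | M =>
      rw [XiKind.map, ih (Fin.init (α := fun _ => XiLetter) w) (h.xiM hn)]
      cases tailKind n k (Fin.init (α := fun _ => XiLetter) w) <;> rfl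
    | G =>
      obtain ⟨z', hz', e⟩ := exists_intCast_eq_ge n i
      rw [XiKind.map, Spiral.xiG, hi, ih (Fin.init (α := fun _ => XiLetter) w) (.right i z' hz' e)]
      cases tailKind n k (Fin.init (α := fun _ => XiLetter) w) with
      | L => simp only [spiralWalk, e, hiz]
      | M => rw [spiralWalk_pos hz', e, ← hiz]; rfl
      | G => simp only [spiralWalk, e, hiz]

theorem tailKind_eq {n k : ℕ} (hk : 1 ≤ k) {w : Fin (n + k) → XiLetter} {a : XiKind}
    (h : ∀ j : Fin k, (w (Fin.natAdd n j)).1 = a) : tailKind n k w = a := by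
  induction k, hk using Nat.le_induction with
  | base => exact h 0
  | succ k hk ih =>
    have h1 := ih (w := Fin.init (α := fun _ => XiLetter) w) fun j => h j.castSucc
    have h2 : (w (Fin.last (n + k))).1 = a := h (Fin.last k)
    rw [tailKind, h1, h2]
    cases a <;> rfl

/-! ### Wrapping sequences around spirals -/

/-- The repetitions are taken at multiples of `m`, with `m = n!` below, so that closing up the
sequence there respects positions in the cycles of the `n`-spiral. -/
theorem exists_lt_mul_eq {P : Type*} [Finite P] (c : ℤ → P) {m : ℕ} (M : ℕ) :
    ∃ i j : ℕ, M ≤ i ∧ i < j ∧ c (m * i) = c (m * j) := by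
  obtain ⟨i, j, hne, h⟩ := Finite.exists_ne_map_eq_of_infinite
    fun i : ℕ => c (m * ((M + i : ℕ) : ℤ))
  rcases lt_or_gt_of_ne hne with h' | h'
  · exact ⟨M + i, M + j, by omega, by omega, h⟩
  · exact ⟨M + j, M + i, by omega, by omega, h.symm⟩

/-- Repeating the stretch of `c` between the equal values at `K` and `K + d` forever, one moves on
as in the sequence `c` at each time. -/
theorem apply_add_emod_succ {P : Type*} {c : ℤ → P} {K d : ℤ} (hd : 0 < d) (h : c K = c (K + d))
    (k : ℤ) : c (K + (k + 1 - K) % d) = c (K + (k - K) % d + 1) := by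
  have h0 := Int.emod_nonneg (k - K) hd.ne'
  have h1 := Int.emod_lt_of_pos (k - K) hd
  have h2 : (k + 1 - K) % d = ((k - K) % d + 1) % d := by
    rw [show k + 1 - K = (k - K) + 1 by ring, Int.emod_add_emod]
  rcases eq_or_lt_of_le (Int.add_one_le_of_lt h1) with h3 | h3
  · rw [h2, h3, Int.emod_self, add_zero, h, add_assoc, h3]
  · rw [h2, Int.emod_eq_of_lt (by omega) h3, add_assoc]

theorem emod_eq_emod_of_intCast_eq {N : ℕ} {d : ℤ} (hd : d ∣ N.factorial) {i j K : ℤ}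
    (h : (i : ZMod N.factorial) = j) : (i - K) % d = (j - K) % d := by
  rw [ZMod.intCast_eq_intCast_iff_dvd_sub] at h
  refine (Int.emod_emod_of_dvd _ (dvd_refl d)).symm.trans ?_
  refine (Int.emod_emod_of_dvd _ (dvd_refl d)).trans (Int.ModEq.sub_right K ?_)
  exact Int.modEq_iff_dvd.mpr (hd.trans h)

theorem intCast_add_emod {m : ℕ} {K d : ℤ} (hd : (m : ℤ) ∣ d) (k : ℤ) :
    ((K + (k - K) % d : ℤ) : ZMod m) = k := by
  rw [ZMod.intCast_eq_intCast_iff_dvd_sub]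
  have h := Int.emod_add_mul_ediv (k - K) d
  have : k - (K + (k - K) % d) = d * ((k - K) / d) := by linarith
  rw [this]
  exact hd.mul_right _

/-- A bi-infinite sequence with finitely many values can be wrapped around all sufficiently large
spirals: along the relation of the spiral the value moves on as in the sequence, the cycles being
closed up by jumps between equal values far away, and a given stretch of the sequence stays
intact. -/
theorem exists_represents {P : Type*} [Finite P] (c : ℤ → P) {n : ℕ} (M : ℕ) (hM : n ≤ M)
    (hM1 : 1 ≤ M) :
    ∃ N₀, M ≤ N₀ ∧ ∀ N ≥ N₀, ∃ g : Spiral N → ℤ,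
      (∀ s t, Spiral.Rel N s t → c (g t) = c (g s + 1)) ∧ (∀ s, Represents n N s (g s)) ∧
      ∀ (k : ℤ) hk, |k| < M → g (.mid k hk) = k := by
  set m := n.factorial with hm
  have hm0 : (1 : ℤ) ≤ m := by exact_mod_cast n.factorial_pos
  obtain ⟨i, j, hi, hij, hc⟩ := exists_lt_mul_eq c (m := m) M
  obtain ⟨i', j', hi', hij', hc'⟩ := exists_lt_mul_eq (fun k => c (-k)) (m := m) M
  -- The right cycle repeats the values between `K` and `K + d`, the left one those between `L`
  -- and `L + e`.
  obtain ⟨K, d, hK, hd, hmd, hcd⟩ : ∃ K d : ℤ, M ≤ K ∧ 0 < d ∧ (m : ℤ) ∣ d ∧ c K = c (K + d) :=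
    ⟨m * i, m * (j - i), by
      have : (M : ℤ) ≤ i := by exact_mod_cast hi
      nlinarith, mul_pos (by omega) (by omega), dvd_mul_right _ _, by rw [hc]; congr 1; ring⟩
  obtain ⟨L, e, hL, he, hme, hce⟩ : ∃ L e : ℤ, L + e ≤ -M ∧ 0 < e ∧ (m : ℤ) ∣ e ∧
      c L = c (L + e) :=
    ⟨-(m * j'), m * (j' - i'), by
      have : (M : ℤ) ≤ i' := by exact_mod_cast hi'
      nlinarith, mul_pos (by omega) (by omega), dvd_mul_right _ _, by
      rw [← hc']; congr 1; ring⟩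
  refine ⟨(K + d + (-L)).toNat, by omega, fun N hN => ?_⟩
  have hdN : d ∣ N.factorial := by
    lift d to ℕ using hd.le
    exact Int.natCast_dvd_natCast.mpr (Nat.dvd_factorial (by omega) (by omega))
  have heN : e ∣ N.factorial := by
    lift e to ℕ using he.le
    exact Int.natCast_dvd_natCast.mpr (Nat.dvd_factorial (by omega) (by omega))
  set wL : ℤ → ℤ := fun k => L + (k - L) % e with hGL
  set wR : ℤ → ℤ := fun k => K + (k - K) % d with hGR
  have hGLb : ∀ k, L ≤ wL k ∧ wL k < L + e := fun k => by
    have h0 := Int.emod_nonneg (k - L) he.ne'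
    have h1 := Int.emod_lt_of_pos (k - L) he
    simp only [hGL]; omega
  have hGRb : ∀ k, K ≤ wR k := fun k => by
    have h0 := Int.emod_nonneg (k - K) hd.ne'
    simp only [hGR]; omega
  let G : ℤ → ℤ := fun k => if k < L + e then wL k else if k < K then k else wR k
  have hG1 : ∀ k, k < L + e → G k = wL k := fun k h => by simp [G, h]
  have hG2 : ∀ k, L + e ≤ k → k < K → G k = k := fun k h h' => by simp [G, h', not_lt.mpr h]
  have hG3 : ∀ k, K ≤ k → G k = wR k := fun k h => by
    have : ¬ k < L + e := by omega
    simp [G, this, not_lt.mpr h]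
  let g : Spiral N → ℤ := fun s => match s with
    | .left k => wL (k.cast : ℤ)
    | .mid k _ => G k
    | .right k => wR (k.cast : ℤ)
  have hgl : ∀ k : ℤ, g (.left k) = wL k := fun k => by
    simp only [g, hGL]
    rw [emod_eq_emod_of_intCast_eq heN (ZMod.intCast_zmod_cast (k : ZMod N.factorial))]
  have hgr : ∀ k : ℤ, g (.right k) = wR k := fun k => by
    simp only [g, hGR]
    rw [emod_eq_emod_of_intCast_eq hdN (ZMod.intCast_zmod_cast (k : ZMod N.factorial))]
  have hstepL : ∀ k, c (wL (k + 1)) = c (wL k + 1) := apply_add_emod_succ he hce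
  have hstepR : ∀ k, c (wR (k + 1)) = c (wR k + 1) := apply_add_emod_succ hd hcd
  have hstep : ∀ k, c (G (k + 1)) = c (G k + 1) := by
    intro k
    rcases lt_trichotomy (k + 1) (L + e) with h | h | h
    · rw [hG1 k (by omega), hG1 _ h, hstepL]
    · have h1 : wL k = k := by
        simp only [hGL]
        rw [Int.emod_eq_of_lt (by omega) (by omega)]
        ring
      rw [hG1 k (by omega), h1, hG2 (k + 1) (by omega) (by omega)]
    · rcases lt_trichotomy (k + 1) K with h' | h' | h'
      · rw [hG2 k (by omega) (by omega), hG2 (k + 1) (by omega) h']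
      · have h1 : wR (k + 1) = k + 1 := by
          simp only [hGR, h']
          simp
        rw [hG2 k (by omega) (by omega), hG3 (k + 1) (by omega), h1]
      · rw [hG3 k (by omega), hG3 (k + 1) (by omega), hstepR]
  refine ⟨g, ?_, ?_, ?_⟩
  · intro s t hst
    cases hst with
    | left k =>
      obtain ⟨k, rfl⟩ := ZMod.intCast_surjective k
      have := hgl (k + 1)
      push_cast at this
      rw [this, hgl, hstepL]
    | right k =>
      obtain ⟨k, rfl⟩ := ZMod.intCast_surjective k
      have := hgr (k + 1)
      push_cast at this
      rw [this, hgr, hstepR]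
    | mid k hk hk' => exact hstep k
    | enter h =>
      rw [hgl, ← hstepL, show g (.mid (-(N : ℤ) + 1) h) = G (-(N : ℤ) + 1) from rfl,
        hG1 _ (by omega)]
    | exit h =>
      have := hgr (N : ℤ)
      rw [this, show g (.mid ((N : ℤ) - 1) h) = G ((N : ℤ) - 1) from rfl, hG3 _ (by omega),
        ← hstepR, sub_add_cancel]
  · intro s
    rcases s with k | ⟨k, hk⟩ | k
    · obtain ⟨k, rfl⟩ := ZMod.intCast_surjective k
      rw [hgl]
      exact .left k _ (by have := hGLb k; omega) (intCast_add_emod hme k)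
    · change Represents n N _ (G k)
      rcases lt_or_ge k (L + e) with h | h
      · rw [hG1 k h]
        have := hGLb k
        exact .mid k hk _ (fun h' => by have := abs_lt.mp h'; omega) (fun _ => by omega)
          (fun _ => by omega) (intCast_add_emod hme k)
      · rcases lt_or_ge k K with h' | h'
        · rw [hG2 k h h']
          exact .mid k hk _ (fun _ => rfl) id id rfl
        · rw [hG3 k h']
          have := hGRb k
          exact .mid k hk _ (fun h' => by have := abs_lt.mp h'; omega) (fun _ => by omega)
            (fun _ => by omega) (intCast_add_emod hmd k)
    · obtain ⟨k, rfl⟩ := ZMod.intCast_surjective k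
      rw [hgr]
      exact .right k _ (by have := hGRb k; omega) (intCast_add_emod hmd k)
  · intro k hk hkM
    have := abs_lt.mp hkM
    exact hG2 k (by omega) (by omega)

/-! ### Orbits seen through a spiral map -/

theorem Homeomorph.zpow_add_one_apply {X : Type*} [TopologicalSpace X] (σ : X ≃ₜ X) (k : ℤ)
    (x : X) :
    (σ ^ (k + 1)) x = σ ((σ ^ k) x) := by
  rw [add_comm, zpow_one_add]; rfl

theorem Homeomorph.zpow_add_apply {X : Type*} [TopologicalSpace X] (σ : X ≃ₜ X) (k l : ℤ) (x : X) :
    (σ ^ (k + l)) x = (σ ^ k) ((σ ^ l) x) := by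
  rw [zpow_add]; rfl

theorem IsSpiralMap.xiIter {X : Type*} [TopologicalSpace X] {σ : X ≃ₜ X} {n : ℕ} (hn : 1 ≤ n)
    {k : ℕ} {φ : X → SpiralUnion (n + k)} (h : IsSpiralMap σ φ) :
    IsSpiralMap σ (SpiralUnion.xiIter n k ∘ φ) := by
  induction k with
  | zero => exact h
  | succ k ih => exact ih (IsSpiralMap.xi (n := n + k) (by omega) h)

section

variable {X : Type*} [TopologicalSpace X] {σ : X ≃ₜ X} {n : ℕ} {φ : X → SpiralUnion n}

theorem IsSpiralMap.rel_zpow (hφ : IsSpiralMap σ φ) (x : X) (k : ℤ) :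
    SpiralUnion.Rel n (φ ((σ ^ k) x)) (φ ((σ ^ (k + 1)) x)) := by
  rw [Homeomorph.zpow_add_one_apply]
  exact hφ.rel _

theorem IsSpiralMap.fst_zpow (hφ : IsSpiralMap σ φ) (x : X) (k : ℤ) :
    (φ ((σ ^ k) x)).1 = (φ x).1 := by
  induction k using Int.induction_on with
  | zero => simp
  | succ k ih => rw [← ih, (hφ.rel_zpow x k).1]
  | pred k ih =>
    rw [← ih, (hφ.rel_zpow x (-k - 1)).1, sub_add_cancel]

/-- Every orbit runs through one of the standard walks of the spiral in which it lies. -/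
theorem IsSpiralMap.exists_orbit_through (hn : 1 ≤ n) (hφ : IsSpiralMap σ φ) (x : X) :
    ∃ (a : XiKind) (z : ℤ) (y : X), (σ ^ z) y = x ∧
      ∀ k : ℤ, φ ((σ ^ k) y) = ((φ x).1, spiralWalk n a k) := by
  obtain ⟨a, z, h⟩ := exists_eq_spiralWalk hn (fun k => (φ ((σ ^ k) x)).2)
    fun k => (hφ.rel_zpow x k).2
  refine ⟨a, z, (σ ^ (-z)) x, ?_, fun k => ?_⟩
  · rw [← Homeomorph.zpow_add_apply]; simp
  · rw [← Homeomorph.zpow_add_apply]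
    refine Prod.ext (hφ.fst_zpow x _) ?_
    have := h (k + -z)
    simpa using this

/-- All standard walks of all spirals arise from orbits; those around the cycles are obtained by
compactness. -/
theorem IsSpiralMap.exists_orbit [CompactSpace X] (hn : 1 ≤ n) (hφ : IsSpiralMap σ φ)
    (u : Fin n → XiLetter) (a : XiKind) :
    ∃ y, ∀ k : ℤ, φ ((σ ^ k) y) = (u, spiralWalk n a k) := by
  have hclosed : ∀ (k : ℤ) (S : Set (SpiralUnion n)), IsClosed {x | φ ((σ ^ k) x) ∈ S} :=
    fun k S => (isOpen_compl_iff.mp (hφ.locallyConstant Sᶜ)).preimage (σ ^ k).continuous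
  cases a with
  | M =>
    obtain ⟨x, hx⟩ := hφ.surjective (u, .mid 0 (by rw [abs_zero]; exact_mod_cast hn))
    obtain ⟨a, z, y, hy, h⟩ := hφ.exists_orbit_through hn x
    have h0 := h z
    rw [hy, hx] at h0
    cases a with
    | M => exact ⟨y, by simpa [hx] using h⟩
    | L => simp [spiralWalk] at h0
    | G => simp [spiralWalk] at h0
  | L =>
    obtain ⟨x, hx⟩ : (⋂ i : ℕ, {x | φ ((σ ^ (i : ℤ)) x) ∈
        {p | p.1 = u ∧ ∃ j, p.2 = .left j}}).Nonempty := by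
      refine IsCompact.nonempty_iInter_of_sequence_nonempty_isCompact_isClosed _ ?_ ?_
        (hclosed _ _).isCompact fun i => hclosed _ _
      · rintro i x ⟨h1, j, h2⟩
        have hr := hφ.rel_zpow x i
        push_cast at h1 h2
        obtain ⟨h3, h4⟩ := hr
        rw [h2] at h4
        exact ⟨h3.trans h1, _, h4.eq_left_of⟩
      · intro i
        obtain ⟨x, hx⟩ := hφ.surjective (u, .left 0)
        refine ⟨(σ ^ (-(i : ℤ))) x, ?_⟩
        change φ ((σ ^ (i : ℤ)) ((σ ^ (-(i : ℤ))) x)) ∈ {p | p.1 = u ∧ ∃ j, p.2 = .left j}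
        rw [← Homeomorph.zpow_add_apply, add_neg_cancel, zpow_zero]
        exact ⟨by rw [Homeomorph.one_apply, hx], 0, by rw [Homeomorph.one_apply, hx]⟩
    have hx' : ∀ i : ℕ, (φ ((σ ^ (i : ℤ)) x)).1 = u ∧ ∃ j, (φ ((σ ^ (i : ℤ)) x)).2 = .left j :=
      fun i => mem_iInter.mp hx i
    obtain ⟨a, z, y, hy, h⟩ := hφ.exists_orbit_through hn x
    have hu : (φ x).1 = u := by simpa using (hx' 0).1
    rw [hu] at h
    obtain ⟨j, hj⟩ := (hx' (n + z.natAbs)).2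
    rw [← hy, ← Homeomorph.zpow_add_apply, h] at hj
    cases a with
    | L => exact ⟨y, h⟩
    | M => rw [spiralWalk_pos (by omega)] at hj; cases hj
    | G => cases hj
  | G =>
    obtain ⟨x, hx⟩ : (⋂ i : ℕ, {x | φ ((σ ^ (-(i : ℤ))) x) ∈
        {p | p.1 = u ∧ ∃ j, p.2 = .right j}}).Nonempty := by
      refine IsCompact.nonempty_iInter_of_sequence_nonempty_isCompact_isClosed _ ?_ ?_
        (hclosed _ _).isCompact fun i => hclosed _ _
      · rintro i x ⟨h1, j, h2⟩
        have hr := hφ.rel_zpow x (-((i + 1 : ℕ) : ℤ))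
        obtain ⟨h3, h4⟩ := hr
        have e : -((i + 1 : ℕ) : ℤ) + 1 = -(i : ℤ) := by push_cast; ring
        rw [e] at h3 h4
        rw [h2] at h4
        exact ⟨h3.symm.trans h1, _, h4.eq_of_right⟩
      · intro i
        obtain ⟨x, hx⟩ := hφ.surjective (u, .right 0)
        refine ⟨(σ ^ (i : ℤ)) x, ?_⟩
        change φ ((σ ^ (-(i : ℤ))) ((σ ^ (i : ℤ)) x)) ∈ {p | p.1 = u ∧ ∃ j, p.2 = .right j}
        rw [← Homeomorph.zpow_add_apply, neg_add_cancel, zpow_zero]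
        exact ⟨by rw [Homeomorph.one_apply, hx], 0, by rw [Homeomorph.one_apply, hx]⟩
    have hx' : ∀ i : ℕ, (φ ((σ ^ (-(i : ℤ))) x)).1 = u ∧
        ∃ j, (φ ((σ ^ (-(i : ℤ))) x)).2 = .right j := fun i => mem_iInter.mp hx i
    obtain ⟨a, z, y, hy, h⟩ := hφ.exists_orbit_through hn x
    have hu : (φ x).1 = u := by simpa using (hx' 0).1
    rw [hu] at h
    obtain ⟨j, hj⟩ := (hx' (n + z.natAbs)).2
    rw [← hy, ← Homeomorph.zpow_add_apply, h] at hj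
    cases a with
    | L => cases hj
    | M => rw [spiralWalk_neg hn (by omega)] at hj; cases hj
    | G => exact ⟨y, h⟩

/-- Wrapping the orbit of `y` around large spirals, keeping the transition at time `z`. -/
theorem exists_wrap_orbit {P : Type*} [Finite P] (σ : X ≃ₜ X) (c : X → P) (n : ℕ) (y : X) (z : ℤ) :
    ∃ N₀, ∀ N ≥ N₀, ∃ g : Spiral N → ℤ, (∀ s, Represents n N s (g s)) ∧
      (∀ s t, Spiral.Rel N s t → c ((σ ^ g t) y) = c (σ ((σ ^ g s) y))) ∧
      ∃ s t, Spiral.Rel N s t ∧ g s = z := by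
  obtain ⟨N₀, hN₀, h⟩ := exists_represents (fun k => c ((σ ^ k) y)) (n := n) (n + z.natAbs + 1)
    (by omega) (by omega)
  refine ⟨N₀, fun N hN => ?_⟩
  obtain ⟨g, h1, h2, h3⟩ := h N hN
  refine ⟨g, h2, fun s t hst => ?_, ?_⟩
  · rw [h1 s t hst, Homeomorph.zpow_add_one_apply]
  · have hz : |z| < ((n + z.natAbs + 1 : ℕ) : ℤ) := by push_cast; omega
    obtain ⟨t, ht⟩ := Spiral.exists_rel (n := N) (.mid z (by omega))
    exact ⟨_, t, ht, h3 z _ hz⟩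

end

theorem exists_surjective_bits (E : Type*) [Finite E] [Nonempty E] :
    ∃ k₀, ∀ k ≥ k₀, ∃ β : (Fin k → Fin 2) → E, Function.Surjective β := by
  refine ⟨Nat.card E, fun k hk => ?_⟩
  let i : E → Fin k → Fin 2 := fun e =>
    Pi.single (Fin.castLE hk (Finite.equivFin E e)) 1
  have hi : Function.Injective i := fun e e' h => by
    have h1 := congrFun h (Fin.castLE hk (Finite.equivFin E e))
    by_contra hne
    have h2 : Fin.castLE hk (Finite.equivFin E e) ≠ Fin.castLE hk (Finite.equivFin E e') :=
      fun h => hne ((Finite.equivFin E).injective (Fin.castLE_injective hk h))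
    simp [i, Pi.single_eq_of_ne h2] at h1
  exact ⟨_, Function.invFun_surjective hi⟩

/-! ### Approximation by homeomorphisms that map onto spiral unions -/

/-- Up to a given clopen partition, every homeomorphism of the Cantor set agrees with one that maps
onto the first spiral union. -/
theorem exists_approx_isSpiralMap_one {P : Type*} [Finite P] (σ : (ℕ → Bool) ≃ₜ (ℕ → Bool))
    {c : (ℕ → Bool) → P} (hc : IsLocallyConstant c) :
    ∃ τ : (ℕ → Bool) ≃ₜ (ℕ → Bool), (∀ x, c (τ x) = c (σ x)) ∧
      ∃ φ : (ℕ → Bool) → SpiralUnion 1, IsSpiralMap τ φ := by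
  let E := range fun x => (c x, c (σ x))
  have : Nonempty E := ⟨⟨_, fun _ => false, rfl⟩⟩
  choose x hx using fun e : E => e.2
  choose N₀ hN₀ using fun e : E => exists_wrap_orbit σ c 1 (x e) 0
  obtain ⟨k₀, hk₀⟩ := exists_surjective_bits E
  obtain ⟨N₁, hN₁⟩ : ∃ N₁, ∀ e, N₀ e ≤ N₁ := (Set.finite_range N₀).bddAbove.imp
    fun N h e => h ⟨e, rfl⟩
  let k := max k₀ N₁
  obtain ⟨β, hβ⟩ := hk₀ k (le_max_left _ _)
  choose g _ hg hg' using fun e => hN₀ e (1 + k) ((hN₁ e).trans (by omega))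
  let A : (Fin (1 + k) → XiLetter) → E := fun w => β fun j => (w (Fin.natAdd 1 j)).2
  obtain ⟨τ, ψ, hτ, hψ, hψs, hψR, -⟩ := exists_homeomorph_of_graph σ
    (W := SpiralUnion (1 + k)) (R := SpiralUnion.Rel (1 + k)) SpiralUnion.exists_rel
    SpiralUnion.exists_rel_left hc (fun p => c ((σ ^ g (A p.1) p.2) (x (A p.1))))
    (by
      rintro ⟨w, s⟩ ⟨w', t⟩ ⟨rfl, hst⟩
      exact ⟨_, rfl, (hg _ s t hst).symm⟩)
    (by
      intro x₀
      let e : E := ⟨_, x₀, rfl⟩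
      obtain ⟨b, hb⟩ := hβ e
      let w : Fin (1 + k) → XiLetter := Fin.append (fun _ => (.M, 0)) fun j => (.M, b j)
      have hA : A w = e := by simp [A, w, hb]
      obtain ⟨s, t, hst, hs⟩ := hg' e
      have he : c (x e) = c x₀ ∧ c (σ (x e)) = c (σ x₀) := Prod.mk.inj (hx e)
      refine ⟨(w, s), (w, t), ⟨rfl, hst⟩, ?_, ?_⟩
      · simp only [hA, hs, zpow_zero, Homeomorph.one_apply, he.1]
      · simp only [hA]
        rw [hg _ s t hst, hs, zpow_zero, Homeomorph.one_apply, he.2])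
  exact ⟨τ, hτ, _, IsSpiralMap.xiIter le_rfl ⟨hψ, hψs, hψR⟩⟩

/-- Up to a given clopen partition, every homeomorphism `σ` of the Cantor set agrees with one for
which a given map of `(X, σ)` onto a spiral union lifts to one that refines the partition. -/
theorem exists_approx_lift {P : Type*} [Finite P] {σ : (ℕ → Bool) ≃ₜ (ℕ → Bool)}
    {c : (ℕ → Bool) → P} (hc : IsLocallyConstant c) {n : ℕ} (hn : 1 ≤ n)
    {φ : (ℕ → Bool) → SpiralUnion n} (hφ : IsSpiralMap σ φ) (hcφ : ∀ x y, c x = c y → φ x = φ y) :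
    ∃ τ : (ℕ → Bool) ≃ₜ (ℕ → Bool), (∀ x, c (τ x) = c (σ x)) ∧
      ∃ k, 1 ≤ k ∧ ∃ ψ : (ℕ → Bool) → SpiralUnion (n + k), IsSpiralMap τ ψ ∧
        (∀ x y, ψ x = ψ y → c x = c y) ∧ φ = SpiralUnion.xiIter n k ∘ ψ := by
  let E := range fun x => (c x, c (σ x))
  have : Nonempty E := ⟨⟨_, fun _ => false, rfl⟩⟩
  choose x hx using fun e : E => e.2
  -- The orbits to be wrapped: one through each transition, and one for each spiral and kind of
  -- walk.
  choose a z y hy hya using fun e : E => hφ.exists_orbit_through hn (x e)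
  choose y' hya' using fun l : (Fin n → XiLetter) × XiKind => hφ.exists_orbit hn l.1 l.2
  let I := E ⊕ (Fin n → XiLetter) × XiKind
  let pt : I → (ℕ → Bool) := Sum.elim y y'
  let time : I → ℤ := Sum.elim z fun _ => 0
  let label : I → (Fin n → XiLetter) × XiKind := Sum.elim (fun e => ((φ (x e)).1, a e)) id
  have hpt : ∀ (i : I) (k : ℤ), φ ((σ ^ k) (pt i)) = ((label i).1, spiralWalk n (label i).2 k) := by
    rintro (e | l) k
    exacts [hya e k, hya' l k]
  choose N₀ hN₀ using fun i : I => exists_wrap_orbit σ c n (pt i) (time i)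
  obtain ⟨k₀, hk₀⟩ := exists_surjective_bits E
  obtain ⟨N₁, hN₁⟩ : ∃ N₁, ∀ i, N₀ i ≤ N₁ := (Set.finite_range N₀).bddAbove.imp
    fun N h e => h ⟨e, rfl⟩
  let k := max k₀ (N₁ + 1)
  have hk1 : 1 ≤ k := by omega
  obtain ⟨β, hβ⟩ := hk₀ k (le_max_left _ _)
  choose g hgr hg hg' using fun i => hN₀ i (n + k) ((hN₁ i).trans (by omega))
  -- The second entries of the last `k` letters of a word select a transition, which is used if
  -- its orbit is of the kind prescribed by the word.
  classical
  let lab : (Fin (n + k) → XiLetter) → (Fin n → XiLetter) × XiKind :=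
    fun w => (fun i => w (Fin.castAdd k i), tailKind n k w)
  let sel : (Fin (n + k) → XiLetter) → E := fun w => β fun j => (w (Fin.natAdd n j)).2
  let A : (Fin (n + k) → XiLetter) → I := fun w =>
    if label (.inl (sel w)) = lab w then .inl (sel w) else .inr (lab w)
  have hA : ∀ w, label (A w) = lab w := by
    intro w
    simp only [A]
    split_ifs with h
    exacts [h, rfl]
  obtain ⟨τ, ψ, hτ, hψ, hψs, hψR, hψc⟩ := exists_homeomorph_of_graph σ
    (W := SpiralUnion (n + k)) (R := SpiralUnion.Rel (n + k)) SpiralUnion.exists_rel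
    SpiralUnion.exists_rel_left hc (fun p => c ((σ ^ g (A p.1) p.2) (pt (A p.1))))
    (by
      rintro ⟨w, s⟩ ⟨w', t⟩ ⟨rfl, hst⟩
      exact ⟨_, rfl, (hg _ s t hst).symm⟩)
    (by
      intro x₀
      let e : E := ⟨_, x₀, rfl⟩
      obtain ⟨b, hb⟩ := hβ e
      let w : Fin (n + k) → XiLetter := Fin.append (φ (x e)).1 fun j => (a e, b j)
      have hsel : sel w = e := by simp [sel, w, hb]
      have hlab : lab w = label (.inl e) := by
        refine Prod.ext ?_ ?_
        · simp [lab, w, label]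
        · exact tailKind_eq hk1 fun j => by simp [w, label]
      have hAw : A w = .inl e := by simp only [A, hsel, hlab, if_true]
      obtain ⟨s, t, hst, hs⟩ := hg' (.inl e)
      have he : c (x e) = c x₀ ∧ c (σ (x e)) = c (σ x₀) := Prod.mk.inj (hx e)
      have hpe : (σ ^ time (.inl e)) (pt (.inl e)) = x e := hy e
      refine ⟨(w, s), (w, t), ⟨rfl, hst⟩, ?_, ?_⟩
      · simp only [hAw, hs, hpe, he.1]
      · simp only [hAw]
        rw [hg _ s t hst, hs, hpe, he.2])
  refine ⟨τ, hτ, k, hk1, ψ, ⟨hψ, hψs, hψR⟩, fun x y h => ?_, funext fun x => ?_⟩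
  · calc c x = _ := (hψc x).symm
      _ = _ := by rw [h]
      _ = c y := hψc y
  · rw [← hcφ _ _ (hψc x), hpt, hA, Function.comp_apply]
    refine Prod.ext ?_ ?_
    · rw [xiIter_fst]
    · exact (xiIter_snd hn (ψ x).1 (hgr _ _)).symm

/-! ### Generic homeomorphisms have the lifting property -/

section

attribute [local instance] homeoTopology

instance : (𝓤 Bool).IsCountablyGenerated :=
  inferInstanceAs (𝓟 SetRel.id).IsCountablyGenerated

theorem continuous_homeo_prod (X : Type*) [TopologicalSpace X] :
    Continuous fun g : X ≃ₜ X => ((g : C(X, X)), (g.symm : C(X, X))) := continuous_induced_dom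

/-- The group of homeomorphisms of a compact metrizable space is a Baire space: it is closed in
the product of two copies of the space of continuous maps. -/
theorem baireSpace_homeo (X : Type*) [UniformSpace X] [CompactSpace X] [T0Space X]
    [(𝓤 X).IsCountablyGenerated] : BaireSpace (X ≃ₜ X) := by
  have hemb : IsClosedEmbedding fun g : X ≃ₜ X => ((g : C(X, X)), (g.symm : C(X, X))) := by
    refine ⟨⟨⟨rfl⟩, fun g h e => ?_⟩, ?_⟩
    · ext x
      exact DFunLike.congr_fun (Prod.mk.inj e).1 x
    · have : range (fun g : X ≃ₜ X => ((g : C(X, X)), (g.symm : C(X, X)))) =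
          {p | p.1.comp p.2 = ContinuousMap.id X ∧ p.2.comp p.1 = ContinuousMap.id X} := by
        ext p
        constructor
        · rintro ⟨g, rfl⟩
          exact ⟨by ext x; simp, by ext x; simp⟩
        · rintro ⟨h1, h2⟩
          exact ⟨⟨⟨p.1, p.2, fun x => DFunLike.congr_fun h2 x, fun x => DFunLike.congr_fun h1 x⟩,
            p.1.continuous, p.2.continuous⟩, rfl⟩
      rw [this]
      exact (isClosed_eq (continuous_fst.compCM continuous_snd) continuous_const).inter
        (isClosed_eq (continuous_snd.compCM continuous_fst) continuous_const)
  have : TopologicalSpace.MetrizableSpace C(X, X) := UniformSpace.metrizableSpace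
  have : TopologicalSpace.IsCompletelyMetrizableSpace C(X, X) :=
    .of_completeSpace_metrizable
  have := hemb.IsCompletelyMetrizableSpace
  infer_instance

theorem eventually_comp_eq {X E : Type*} [UniformSpace X] [CompactSpace X] {c : X → E}
    (hc : IsLocallyConstant c) (σ : X ≃ₜ X) : ∀ᶠ τ in 𝓝 σ, ∀ x, c (τ x) = c (σ x) := by
  let _ : UniformSpace E := ⊥
  have hu := CompactSpace.uniformContinuous_of_continuous hc.continuous
  have hV : {p : X × X | c p.1 = c p.2} ∈ 𝓤 X := hu (mem_principal_self SetRel.id)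
  have ht : Tendsto (fun τ : X ≃ₜ X => (τ : C(X, X))) (𝓝 σ) (𝓝 (σ : C(X, X))) :=
    ((continuous_fst.comp (continuous_homeo_prod X)).tendsto σ)
  filter_upwards [ContinuousMap.tendsto_iff_tendstoUniformly.mp ht _ hV] with τ h x
  exact (h x).symm

/-- A homeomorphism is close to `σ` together with its inverse as soon as it agrees with `σ` in
sufficiently many entries. -/
theorem exists_forall_agree_imp_mem {σ : (ℕ → Bool) ≃ₜ (ℕ → Bool)}
    {U : Set ((ℕ → Bool) ≃ₜ (ℕ → Bool))} (hU : U ∈ 𝓝 σ) :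
    ∃ m : ℕ, ∀ τ : (ℕ → Bool) ≃ₜ (ℕ → Bool), (∀ x, ∀ i < m, τ x i = σ x i) → τ ∈ U := by
  let S : ℕ → Set ((ℕ → Bool) ≃ₜ (ℕ → Bool)) := fun m => {τ | ∀ x, ∀ i < m, τ x i = σ x i}
  have hS : Antitone S := fun m m' h τ hτ x i hi => hτ x i (hi.trans_le h)
  suffices h : ⨅ m, 𝓟 (S m) ≤ 𝓝 σ by
    obtain ⟨m, -, hm⟩ := (hasBasis_iInf_principal
      (directed_of_isDirected_le hS)).mem_iff.mp (h hU)
    exact ⟨m, fun τ hτ => hm hτ⟩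
  have hmem : ∀ m, S m ∈ ⨅ m, 𝓟 (S m) := fun m => mem_iInf_of_mem m (mem_principal_self _)
  rw [nhds_induced, nhds_prod_eq, ← tendsto_iff_comap]
  refine Tendsto.prodMk (ContinuousMap.tendsto_iff_tendstoUniformly.mpr fun V hV => ?_)
    (ContinuousMap.tendsto_iff_tendstoUniformly.mpr fun V hV => ?_)
  · obtain ⟨m, hm⟩ := exists_forall_lt_eq_imp_mem hV
    filter_upwards [hmem m] with τ hτ x
    exact hm _ _ fun i hi => (hτ x i hi).symm
  · have hu := CompactSpace.uniformContinuous_of_continuous σ.symm.continuous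
    obtain ⟨m, hm⟩ := exists_forall_lt_eq_imp_mem (hu hV)
    filter_upwards [hmem m] with τ hτ x
    have := hm x (σ (τ.symm x)) fun i hi => by rw [← hτ _ i hi, τ.apply_symm_apply]
    simpa using this

theorem IsSpiralMap.of_comp_eq {X : Type*} [TopologicalSpace X] {σ τ : X ≃ₜ X} {n : ℕ}
    {φ : X → SpiralUnion n} (hφ : IsSpiralMap σ φ) (h : ∀ x, φ (τ x) = φ (σ x)) :
    IsSpiralMap τ φ :=
  ⟨hφ.locallyConstant, hφ.surjective, fun x => h x ▸ hφ.rel x⟩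

theorem residual_exists_isSpiralMap_one :
    {τ : (ℕ → Bool) ≃ₜ (ℕ → Bool) | ∃ φ : (ℕ → Bool) → SpiralUnion 1, IsSpiralMap τ φ} ∈
      residual ((ℕ → Bool) ≃ₜ (ℕ → Bool)) := by
  refine residual_of_dense_open (isOpen_iff_mem_nhds.mpr ?_) (dense_iff_inter_open.mpr ?_)
  · rintro σ ⟨φ, hφ⟩
    filter_upwards [eventually_comp_eq hφ.locallyConstant σ] with τ hτ
    exact ⟨φ, hφ.of_comp_eq hτ⟩
  · rintro U hU ⟨σ, hσ⟩
    obtain ⟨m, hm⟩ := exists_forall_agree_imp_mem (hU.mem_nhds hσ)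
    obtain ⟨τ, hτ, hφ⟩ := exists_approx_isSpiralMap_one σ
      (c := fun x => fun i : Fin m => x i) ((IsLocallyConstant.iff_continuous _).mpr (by fun_prop))
    exact ⟨τ, hm τ fun x i hi => congrFun (hτ x) ⟨i, hi⟩, hφ⟩

/-- The homeomorphisms `τ` for which `φ`, if it is a map of `(X, τ)` onto a spiral union, lifts to
such a map which determines the first `m` entries of a sequence. -/
def liftingSet {n : ℕ} (φ : (ℕ → Bool) → SpiralUnion n) (m : ℕ) :
    Set ((ℕ → Bool) ≃ₜ (ℕ → Bool)) :=
  {τ | IsSpiralMap τ φ → ∃ k, 1 ≤ k ∧ ∃ ψ : (ℕ → Bool) → SpiralUnion (n + k), IsSpiralMap τ ψ ∧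
    (∀ x y, ψ x = ψ y → ∀ i < m, x i = y i) ∧ φ = SpiralUnion.xiIter n k ∘ ψ}

theorem residual_liftingSet {n : ℕ} (hn : 1 ≤ n) {φ : (ℕ → Bool) → SpiralUnion n}
    (hφ : IsLocallyConstant φ) (m : ℕ) :
    liftingSet φ m ∈ residual ((ℕ → Bool) ≃ₜ (ℕ → Bool)) := by
  refine residual_of_dense_open (isOpen_iff_mem_nhds.mpr fun σ hσ => ?_)
    (dense_iff_inter_open.mpr ?_)
  · by_cases h : IsSpiralMap σ φ
    · obtain ⟨k, hk, ψ, hψ, hm, e⟩ := hσ h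
      filter_upwards [eventually_comp_eq hψ.locallyConstant σ] with τ hτ _
      exact ⟨k, hk, ψ, hψ.of_comp_eq hτ, hm, e⟩
    · filter_upwards [eventually_comp_eq hφ σ] with τ hτ h'
      exact absurd (h'.of_comp_eq fun x => (hτ x).symm) h
  · rintro U hU ⟨σ, hσ⟩
    by_cases h : IsSpiralMap σ φ
    · obtain ⟨m₁, hm₁⟩ := exists_forall_agree_imp_mem (hU.mem_nhds hσ)
      obtain ⟨m₂, hm₂⟩ := hφ.exists_forall_lt_eq
      obtain ⟨τ, hτ, k, hk, ψ, hψ, hc, e⟩ := exists_approx_lift (σ := σ)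
        (c := fun x => fun i : Fin (m + m₁ + m₂) => x i)
        ((IsLocallyConstant.iff_continuous _).mpr (by fun_prop)) hn h
        (fun x y hxy => hm₂ x y fun i hi => congrFun hxy ⟨i, by omega⟩)
      exact ⟨τ, hm₁ τ fun x i hi => congrFun (hτ x) ⟨i, by omega⟩, fun _ =>
        ⟨k, hk, ψ, hψ, fun x y hxy i hi => congrFun (hc x y hxy) ⟨i, by omega⟩, e⟩⟩
    · exact ⟨σ, hσ, fun h' => absurd h' h⟩

theorem residual_hasLiftingProperty :
    {τ : (ℕ → Bool) ≃ₜ (ℕ → Bool) | HasLiftingProperty τ} ∈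
      residual ((ℕ → Bool) ≃ₜ (ℕ → Bool)) := by
  have hloc : ∀ {n j : ℕ} (a : (Fin j → Bool) → SpiralUnion n),
      IsLocallyConstant fun x : ℕ → Bool => a fun i => x i := fun {n j} a =>
    ((IsLocallyConstant.iff_continuous fun (x : ℕ → Bool) (i : Fin j) => x i).mpr
      (by fun_prop)).comp a
  -- A locally constant map depends on finitely many entries, so that there are countably many.
  have h : ∀ p : (Σ n : ℕ, Σ j : ℕ, (Fin j → Bool) → SpiralUnion (n + 1)) × ℕ,
      liftingSet (fun x : ℕ → Bool => p.1.2.2 fun i => x i) p.2 ∈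
        residual ((ℕ → Bool) ≃ₜ (ℕ → Bool)) :=
    fun p => residual_liftingSet (by omega) (hloc _) _
  filter_upwards [residual_exists_isSpiralMap_one, countable_iInter_mem.mpr h] with τ h1 h2
  refine ⟨h1, fun n hn φ hφ V hV => ?_⟩
  obtain ⟨n, rfl⟩ : ∃ l, n = l + 1 := ⟨n - 1, by omega⟩
  obtain ⟨j, hj⟩ := hφ.locallyConstant.exists_forall_lt_eq
  obtain ⟨m, hm⟩ := exists_forall_lt_eq_imp_mem hV
  let a : (Fin j → Bool) → SpiralUnion (n + 1) :=
    fun u => φ ((cantorSplit j).symm (u, fun _ => false))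
  have ha : (fun x : ℕ → Bool => a fun i => x i) = φ := funext fun x => hj _ _ fun i hi => by
    simp [cantorSplit, hi]
  have h3 := mem_iInter.mp h2 (⟨n, j, a⟩, m)
  simp only [ha] at h3
  obtain ⟨k, hk, ψ, hψ, hψm, e⟩ := h3 hφ
  exact ⟨k, hk, ψ, hψ, fun x y hxy => hm _ _ (hψm x y hxy), e⟩

theorem IsSpiralMap.conj {X : Type*} [TopologicalSpace X] {σ τ g : X ≃ₜ X}
    (hg : ∀ x, g (σ x) = τ (g x)) {n : ℕ} {φ : X → SpiralUnion n} (hφ : IsSpiralMap τ φ) :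
    IsSpiralMap σ (φ ∘ g) :=
  ⟨hφ.locallyConstant.comp_continuous g.continuous, hφ.surjective.comp g.surjective, fun x => by
    rw [Function.comp_apply, Function.comp_apply, hg]; exact hφ.rel _⟩

theorem HasLiftingProperty.conj {X : Type*} [UniformSpace X] [CompactSpace X] {σ τ g : X ≃ₜ X}
    (hg : ∀ x, g (σ x) = τ (g x)) (hτ : HasLiftingProperty τ) : HasLiftingProperty σ := by
  obtain ⟨φ, hφ⟩ := hτ.1
  refine ⟨⟨_, hφ.conj hg⟩, fun n hn φ hφ V hV => ?_⟩
  have hg' : ∀ x, g.symm (τ x) = σ (g.symm x) := fun x => by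
    rw [Homeomorph.symm_apply_eq, hg, g.apply_symm_apply]
  have hu := CompactSpace.uniformContinuous_of_continuous g.symm.continuous
  obtain ⟨k, hk, ψ, hψ, hψV, e⟩ := hτ.2 n hn _ (hφ.conj hg') _ (hu hV)
  refine ⟨k, hk, _, hψ.conj hg, fun x y h => ?_, ?_⟩
  · simpa using hψV (g x) (g y) h
  · rw [← Function.comp_assoc, ← e]
    funext x
    simp

theorem IsGenericHomeo.hasLiftingProperty {σ : (ℕ → Bool) ≃ₜ (ℕ → Bool)}
    (hσ : IsGenericHomeo σ) : HasLiftingProperty σ := by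
  have := baireSpace_homeo (ℕ → Bool)
  obtain ⟨τ, hτ, hτ'⟩ :=
    (dense_of_mem_residual (inter_mem hσ residual_hasLiftingProperty)).nonempty
  obtain ⟨g, hg⟩ := isConj_iff.mp hτ
  refine HasLiftingProperty.conj (g := g) (fun x => ?_) hτ'
  rw [← hg]
  change g (σ x) = g (σ (g.symm (g x)))
  rw [g.symm_apply_apply]

end

theorem corollary3p6 (σ : (ℕ → Bool) ≃ₜ (ℕ → Bool))
    (hσ : IsGenericHomeo σ ∨ HasLiftingProperty σ) :
    IsPrimeModelOfItsTheory.{0, u}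
      (σ.compStarAlgEquiv' ℂ ℂ : C(ℕ → Bool, ℂ) ≃⋆ₐ[ℂ] C(ℕ → Bool, ℂ)) :=
  (hσ.elim IsGenericHomeo.hasLiftingProperty id).isPrimeModelOfItsTheory
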